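/- Let $\mathbb K$ be a field of characteristic different from $2$ and let $V=\bigoplus_{k\in\mathbb Z}V^k$ be a $\mathbb Z$-graded $\mathbb K$-vector space. In exponents of $-1$ a homogeneous vector stands for its degree. For a graded vector space $W$ let $sW$ be its suspension, $(sW)^k=W^{k-1}$, and let $CLV^n(W)=\prod_{i\ge1}\mathrm{Hom}^n(W^{\otimes i},W)$ be the space of degree $n$ linear maps $\bigoplus_{i\ge 1}W^{\otimes i}\to W$. The graded Balavoine bracket of $f=(f_i)_{i\ge1}\in CLV^m(W)$ and $g=(g_j)_{j\ge 1}\in CLV^n(W)$ is $[f,g]_B=f\bar\circ g-(-1)^{mn}g\bar\circ f\in CLV^{m+n}(W)$, where for homogeneous $v_1,\dots,v_s$ $$(f\bar\circ g)(v_1,\dots,v_s)=\sum_{i+j=s+1}\ \sum_{k=1}^{i}\ \sum_{\sigma\in S_{(k-1,j-1)}}(-1)^{n(v_{\sigma(1)}+\dots+v_{\sigma(k-1)})}\varepsilon(\sigma)\,f_i\big(v_{\sigma(1)},\dots,v_{\sigma(k-1)},g_j(v_{\sigma(k)},\dots,v_{\sigma(k+j-2)},v_{k+j-1}),v_{k+j},\dots,v_s\big),$$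 $S_{(p,q)}$ is the set of $(p,q)$-shuffles and $\varepsilon(\sigma)$ is the Koszul sign of the permutation $\sigma$ of the $v$'s. Let $CV^n(V)=\prod_{p\ge1}\mathrm{Hom}^{n+p-1}\big((V\otimes V)^{\otimes(p-1)}\otimes V,V\big)$, with elements written $f=\sum_{p\ge 1} f_{2p-1}$. For a component $f_{2p-1}$ of $f\in CV^n(V)$, homogeneous $X_1,\dots,X_{p-1}\in V\otimes V$ and homogeneous $x,y\in V$, put $$\widetilde f_p(X_1,\dots,X_{p-1},x\otimes y)=f_{2p-1}(X_1,\dots,X_{p-1},x)\otimes y+(-1)^{x(X_1+\dots+X_{p-1}+n+p-1)}\,x\otimes f_{2p-1}(X_1,\dots,X_{p-1},y)$$ and let $\Psi:CV^n(V)\to CLV^n(s(V\otimes V))$ be given by $(\Psi f_{2p-1})(sX_1,\dots,sX_{p-1},s(x\otimes y))=(-1)^{p(p-1)/2}\,s\,\widetilde f_p(X_1,\dots,X_{p-1},x\otimes y)$. Then the following hold. 1. $\Psi$ is a well-defined injective graded linear map. 2. $(CLV^\bullet(s(V\otimes V)),[\cdot,\cdot]_B)$ is a graded Lie algebra and $\mathrm{Im}\,\Psi$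 is a graded Lie subalgebra of it. 3. Consequently $CV^\bullet(V)$ is a graded Lie algebra with the bracket $[\![f,g]\!]=\Psi^{-1}\big([\Psi f,\Psi g]_B\big)$. Explicitly, $[\![f,g]\!]=f\circ g-(-1)^{mn}g\circ f$ for $f\in CV^m(V)$, $g\in CV^n(V)$, where, for homogeneous $X_1,\dots,X_s\in V\otimes V$ and $x\in V$, $$\begin{aligned}(f\circ g)(X_1,\dots,X_s,x)=\sum_{i+j=s+2}(-1)^{(i-1)(j-1)}\Big(&\sum_{k=1}^{i-1}\sum_{\sigma\in S_{(k-1,j-1)}}(-1)^{\beta_k}\varepsilon(\sigma)f_{2i-1}\big(X_{\sigma(1)},\dots,X_{\sigma(k-1)},\widetilde g_j(X_{\sigma(k)},\dots,X_{\sigma(k+j-2)},X_{k+j-1}),X_{k+j},\dots,X_s,x\big)\\&+\sum_{\sigma\in S_{(i-1,j-1)}}(-1)^{\beta_i}\varepsilon(\sigma)f_{2i-1}\big(X_{\sigma(1)},\dots,X_{\sigma(i-1)},g_{2j-1}(X_{\sigma(i)},\dots,X_{\sigma(s)},x)\big)\Big),\end{aligned}$$ with $i,j\ge1$, $\beta_k=n\sum_{l<k}(X_{\sigma(l)}+1)$,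 and $\varepsilon(\sigma)$ the Koszul sign of the permutation of the suspended vectors $sX_1,\dots,sX_s$, of degrees $X_l+1$. 4. An element $O=\sum_{k\ge1}O_{2k-1}$ is a Maurer–Cartan element of this graded Lie algebra (that is, $O\in CV^1(V)$ and $[\![O,O]\!]=0$) if and only if it is a homotopy Nambu algebra structure on $V$, i.e. every $O_{2k-1}:(V\otimes V)^{\otimes(k-1)}\otimes V\to V$ has degree $k$ and $(O\circ O)(X_1,\dots,X_s,x)=0$ for all $s\ge0$, all homogeneous $X_1,\dots,X_s\in V\otimes V$ and all $x\in V$. -/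

import Mathlib

open scoped TensorProduct

noncomputable section

namespace Nambu

universe u v

section Gradings

variable {𝕜 : Type u} [Field 𝕜] {W : Type v} [AddCommGroup W] [Module 𝕜 W]

/-- The grading of the suspension `s W`: `(s W)^k = W^(k-1)`. The underlying space is unchanged,
so that the degree one map `s : W → s W` is the identity on vectors. -/
def suspension (𝒲 : ℤ → Submodule 𝕜 W) : ℤ → Submodule 𝕜 W := fun k => 𝒲 (k - 1)

/-- The grading of `W ⊗ W`: the degree `k` part is spanned by the tensors `x ⊗ y` of homogeneous
vectors whose degrees add up to `k`. -/
def tensorGrading (𝒲 : ℤ → Submodule 𝕜 W) : ℤ → Submodule 𝕜 (W ⊗[𝕜] W) := fun k =>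
  Submodule.span 𝕜 {t | ∃ i j : ℤ, i + j = k ∧ ∃ x ∈ 𝒲 i, ∃ y ∈ 𝒲 j, x ⊗ₜ[𝕜] y = t}

theorem tmul_mem_tensorGrading {𝒲 : ℤ → Submodule 𝕜 W} {i j k : ℤ} (h : i + j = k) {x y : W}
    (hx : x ∈ 𝒲 i) (hy : y ∈ 𝒲 j) : x ⊗ₜ[𝕜] y ∈ tensorGrading 𝒲 k :=
  Submodule.subset_span ⟨i, j, h, x, hx, y, hy, rfl⟩

variable (𝒲 : ℤ → Submodule 𝕜 W) [DirectSum.Decomposition 𝒲]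

instance suspensionDecomposition : DirectSum.Decomposition (suspension 𝒲) :=
  DirectSum.Decomposition.ofLinearMap (suspension 𝒲)
    ((DirectSum.toModule 𝕜 ℤ (DirectSum ℤ fun i => suspension 𝒲 i) fun i =>
        (DirectSum.lof 𝕜 ℤ (fun i => suspension 𝒲 i) (i + 1)).comp
          (Submodule.inclusion (by simp [suspension]))) ∘ₗ
      (DirectSum.decomposeLinearEquiv 𝒲).toLinearMap)
    (by
      ext x
      induction x using DirectSum.Decomposition.inductionOn 𝒲 with
      | zero => simp
      | @homogeneous i m => simp [DirectSum.decomposeLinearEquiv_apply, DirectSum.toModule_lof,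
          ← DirectSum.lof_eq_of 𝕜]
      | add m m' h h' => rw [map_add, map_add, h, h'])
    (by
      ext i x : 2
      have hx : (x : W) ∈ 𝒲 (i - 1) := x.2
      simp only [LinearMap.comp_apply, DirectSum.coeLinearMap_lof, LinearEquiv.coe_coe,
        DirectSum.decomposeLinearEquiv_apply, LinearMap.id_comp]
      rw [DirectSum.decompose_of_mem 𝒲 hx, ← DirectSum.lof_eq_of 𝕜, DirectSum.toModule_lof]
      simp only [LinearMap.comp_apply]
      apply DFinsupp.single_eq_of_sigma_eq
      exact Sigma.subtype_ext (by simp) rfl)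

/-- The tensor product of two homogeneous components, inside the direct sum of the pieces of
`tensorGrading`. -/
def tensorPiece (i j : ℤ) :
    𝒲 i →ₗ[𝕜] 𝒲 j →ₗ[𝕜] DirectSum ℤ fun k => tensorGrading 𝒲 k :=
  LinearMap.mk₂ 𝕜
    (fun x y => DirectSum.lof 𝕜 ℤ (fun k => tensorGrading 𝒲 k) (i + j)
      ⟨(x : W) ⊗ₜ[𝕜] (y : W), tmul_mem_tensorGrading rfl x.2 y.2⟩)
    (fun x x' y => by
      rw [← map_add]; congr 1; ext; simp [TensorProduct.add_tmul])
    (fun c x y => by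
      rw [← map_smul]; congr 1)
    (fun x y y' => by
      rw [← map_add]; congr 1; ext; simp [TensorProduct.tmul_add])
    (fun c x y => by
      rw [← map_smul]; congr 1; ext; simp)

/-- The decomposition of a tensor into its homogeneous components. -/
def tensorDecompose : W ⊗[𝕜] W →ₗ[𝕜] DirectSum ℤ fun k => tensorGrading 𝒲 k :=
  TensorProduct.lift
    ((DirectSum.toModule 𝕜 ℤ (DirectSum ℤ (fun j => 𝒲 j) →ₗ[𝕜]
        DirectSum ℤ fun k => tensorGrading 𝒲 k) fun i =>
      LinearMap.flip (DirectSum.toModule 𝕜 ℤ _ fun j => (tensorPiece 𝒲 i j).flip)).compl₁₂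
      (DirectSum.decomposeLinearEquiv 𝒲).toLinearMap
      (DirectSum.decomposeLinearEquiv 𝒲).toLinearMap)

theorem tensorDecompose_tmul {i j k : ℤ} (h : i + j = k) {x y : W} (hx : x ∈ 𝒲 i)
    (hy : y ∈ 𝒲 j) :
    tensorDecompose 𝒲 (x ⊗ₜ[𝕜] y) = DirectSum.lof 𝕜 ℤ (fun k => tensorGrading 𝒲 k) k
      ⟨x ⊗ₜ[𝕜] y, tmul_mem_tensorGrading h hx hy⟩ := by
  subst h
  simp only [tensorDecompose, TensorProduct.lift.tmul, LinearMap.compl₁₂_apply,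
    LinearEquiv.coe_coe, DirectSum.decomposeLinearEquiv_apply]
  rw [DirectSum.decompose_of_mem 𝒲 hx, DirectSum.decompose_of_mem 𝒲 hy,
    ← DirectSum.lof_eq_of 𝕜, ← DirectSum.lof_eq_of 𝕜, DirectSum.toModule_lof,
    LinearMap.flip_apply, DirectSum.toModule_lof]
  rfl

instance tensorDecomposition : DirectSum.Decomposition (tensorGrading 𝒲) :=
  DirectSum.Decomposition.ofLinearMap (tensorGrading 𝒲) (tensorDecompose 𝒲)
    (by
      refine TensorProduct.ext' fun x y => ?_
      induction x using DirectSum.Decomposition.inductionOn 𝒲 with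
      | zero => simp
      | add m m' h h' => rw [TensorProduct.add_tmul, map_add, map_add, h, h']
      | homogeneous m =>
        induction y using DirectSum.Decomposition.inductionOn 𝒲 with
        | zero => simp
        | add m m' h h' => rw [TensorProduct.tmul_add, map_add, map_add, h, h']
        | homogeneous m' =>
          rw [LinearMap.comp_apply, tensorDecompose_tmul 𝒲 rfl m.2 m'.2,
            DirectSum.coeLinearMap_lof]
          rfl)
    (by
      ext k t : 2
      obtain ⟨t, ht⟩ := t
      simp only [LinearMap.comp_apply, DirectSum.coeLinearMap_lof, LinearMap.id_comp]
      induction ht using Submodule.span_induction with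
      | mem t h =>
        obtain ⟨i, j, h, x, hx, y, hy, rfl⟩ := h
        exact tensorDecompose_tmul 𝒲 h hx hy
      | zero => exact (map_zero _).trans (map_zero _).symm
      | add a b ha hb h h' =>
        have e : (⟨a + b, Submodule.add_mem _ ha hb⟩ : tensorGrading 𝒲 k) =
          ⟨a, ha⟩ + ⟨b, hb⟩ := rfl
        rw [map_add, h, h', ← map_add, ← e]
      | smul c a ha h =>
        have e : (⟨c • a, Submodule.smul_mem _ c ha⟩ : tensorGrading 𝒲 k) = c • ⟨a, ha⟩ := rfl
        rw [map_smul, h, ← map_smul, ← e])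

/-- The projection of a graded space onto its even part (`c = 0`) or odd part (`c = 1`). -/
def parityProj (c : Fin 2) : W →ₗ[𝕜] W :=
  (DirectSum.toModule 𝕜 ℤ W fun i => if i % 2 = ((c : ℕ) : ℤ) then (𝒲 i).subtype else 0) ∘ₗ
    (DirectSum.decomposeLinearEquiv 𝒲).toLinearMap

theorem parityProj_of_mem (c : Fin 2) {i : ℤ} {x : W} (hx : x ∈ 𝒲 i) :
    parityProj 𝒲 c x = if i % 2 = ((c : ℕ) : ℤ) then x else 0 := by
  simp only [parityProj, LinearMap.comp_apply, LinearEquiv.coe_coe,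
    DirectSum.decomposeLinearEquiv_apply]
  rw [DirectSum.decompose_of_mem 𝒲 hx, ← DirectSum.lof_eq_of 𝕜, DirectSum.toModule_lof]
  split_ifs <;> rfl

end Gradings

section Signs

/-- The sign `(-1)^n`. -/
def sign (𝕜 : Type u) [Field 𝕜] (n : ℤ) : 𝕜 := if Even n then 1 else -1

/-- The Koszul sign `ε(σ)` of a permutation of homogeneous vectors of degrees `d`: every pair of
vectors that is interchanged contributes `(-1)` to the product of the two degrees. -/
def koszulSign (𝕜 : Type u) [Field 𝕜] {N : ℕ} (d : Fin N → ℤ) (σ : Equiv.Perm (Fin N)) : 𝕜 :=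
  sign 𝕜 (∑ i : Fin N, ∑ j : Fin N, if i < j ∧ σ j < σ i then d (σ i) * d (σ j) else 0)

open Classical in
/-- The `(k, b)`-shuffles, as permutations of `Fin N` that move only the first `k + b` places:
they are increasing on the first `k` places and on the following `b` places. -/
def shuffles (N k b : ℕ) : Finset (Equiv.Perm (Fin N)) :=
  Finset.univ.filter fun σ =>
    (∀ i j : Fin N, i < j → (j : ℕ) < k → σ i < σ j) ∧
    (∀ i j : Fin N, k ≤ (i : ℕ) → i < j → (j : ℕ) < k + b → σ i < σ j) ∧
    (∀ i : Fin N, k + b ≤ (i : ℕ) → σ i = i)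

/-- `d_{σ(1)} + ⋯ + d_{σ(k)}`. -/
def leadingDegree {N : ℕ} (d : Fin N → ℤ) (σ : Equiv.Perm (Fin N)) (k : ℕ) : ℤ :=
  ∑ i : Fin N, if (i : ℕ) < k then d (σ i) else 0

end Signs

section Balavoine

variable {𝕜 : Type u} [Field 𝕜] {W : Type v} [AddCommGroup W] [Module 𝕜 W]

/-- Linear maps from the reduced tensor module `⊕_{i ≥ 1} W^{⊗ i}` to `W`, given by their
components: the entry at `a` is the component on `W^{⊗ (a+1)}`. -/
abbrev LeibnizCochain (𝕜 : Type u) [Field 𝕜] (W : Type v) [AddCommGroup W] [Module 𝕜 W] :=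
  (a : ℕ) → MultilinearMap 𝕜 (fun _ : Fin (a + 1) => W) W

/-- The space of linear maps of degree `n` from `⊕_{i ≥ 1} W^{⊗ i}` to `W`. -/
def CLV (𝒲 : ℤ → Submodule 𝕜 W) (n : ℤ) : Submodule 𝕜 (LeibnizCochain 𝕜 W) where
  carrier := {f | ∀ (a : ℕ) (d : Fin (a + 1) → ℤ) (v : Fin (a + 1) → W),
    (∀ i, v i ∈ 𝒲 (d i)) → f a v ∈ 𝒲 (∑ i, d i + n)}
  zero_mem' := fun _ _ _ _ => Submodule.zero_mem _
  add_mem' := fun hf hg a d v hv => Submodule.add_mem _ (hf a d v hv) (hg a d v hv)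
  smul_mem' := fun c _ hf a d v hv => Submodule.smul_mem _ c (hf a d v hv)

/-- The values `f(w_1, …, w_k, g(w_{k+1}, …, w_{k+b+1}), w_{k+b+2}, …, w_{a+b+1})`. -/
def insertFun {a b : ℕ} (f : MultilinearMap 𝕜 (fun _ : Fin (a + 1) => W) W)
    (g : MultilinearMap 𝕜 (fun _ : Fin (b + 1) => W) W) (k : Fin (a + 1))
    (w : Fin (a + b + 1) → W) : W :=
  f fun t =>
    if (t : ℕ) < k then w ⟨t, by omega⟩
    else if t = k then g fun r => w ⟨k + r, by omega⟩
    else w ⟨t + b, by omega⟩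

theorem insertFun_update {a b : ℕ} (f : MultilinearMap 𝕜 (fun _ : Fin (a + 1) => W) W)
    (g : MultilinearMap 𝕜 (fun _ : Fin (b + 1) => W) W) (k : Fin (a + 1))
    (w : Fin (a + b + 1) → W) (l : Fin (a + b + 1)) :
    ∃ L : W →ₗ[𝕜] W, ∀ x, insertFun f g k (Function.update w l x) = L x := by
  set outer : W → (Fin (a + b + 1) → W) → Fin (a + 1) → W := fun y w t =>
    if (t : ℕ) < k then w ⟨t, by omega⟩ else if t = k then y else w ⟨t + b, by omega⟩
    with houter
  have key : ∀ w, insertFun f g k w = f (outer (g fun r => w ⟨k + r, by omega⟩) w) :=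
    fun w => rfl
  by_cases h1 : (l : ℕ) < k
  · refine ⟨f.toLinearMap (outer (g fun r => w ⟨k + r, by omega⟩) w) ⟨l, by omega⟩, fun x => ?_⟩
    rw [key, MultilinearMap.toLinearMap_apply]
    congr 1
    funext t
    simp only [houter, Function.update_apply, Fin.ext_iff]
    split_ifs <;> first | rfl | omega | skip
    all_goals
      congr 1
      funext r
      rw [if_neg (by omega)]
  · by_cases h2 : (l : ℕ) ≤ k + b
    · refine ⟨(f.toLinearMap (outer 0 w) k) ∘ₗ
        (g.toLinearMap (fun r => w ⟨k + r, by omega⟩) ⟨l - k, by omega⟩), fun x => ?_⟩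
      rw [key, LinearMap.comp_apply, MultilinearMap.toLinearMap_apply,
        MultilinearMap.toLinearMap_apply]
      congr 1
      funext t
      simp only [houter, Function.update_apply, Fin.ext_iff]
      split_ifs <;> first | rfl | omega | skip
      all_goals
        congr 1
        funext r
        simp only [Function.update_apply, Fin.ext_iff]
        split_ifs <;> first | rfl | omega
    · refine ⟨f.toLinearMap (outer (g fun r => w ⟨k + r, by omega⟩) w) ⟨l - b, by omega⟩,
        fun x => ?_⟩
      rw [key, MultilinearMap.toLinearMap_apply]
      congr 1
      funext t
      simp only [houter, Function.update_apply, Fin.ext_iff]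
      split_ifs <;> first | rfl | omega | skip
      all_goals
        congr 1
        funext r
        rw [if_neg (by omega)]

/-- The insertion of `g` into the place `k` of `f`, without signs, as a multilinear map. -/
def insertAt {a b : ℕ} (f : MultilinearMap 𝕜 (fun _ : Fin (a + 1) => W) W)
    (g : MultilinearMap 𝕜 (fun _ : Fin (b + 1) => W) W) (k : Fin (a + 1)) :
    MultilinearMap 𝕜 (fun _ : Fin (a + b + 1) => W) W where
  toFun := insertFun f g k
  map_update_add' := fun {inst} w l x y => by
    rw [Subsingleton.elim inst (instDecidableEqFin _)]
    obtain ⟨L, hL⟩ := insertFun_update f g k w l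
    rw [hL, hL, hL, map_add]
  map_update_smul' := fun {inst} w l c x => by
    rw [Subsingleton.elim inst (instDecidableEqFin _)]
    obtain ⟨L, hL⟩ := insertFun_update f g k w l
    rw [hL, hL, map_smul]

/-- Given, for all degrees `d` of the arguments, a multilinear map `F d` that depends on `d` only
through parities, the multilinear map whose value on homogeneous arguments of degrees `d` is that
of `F d` (see `homogeneousGlue_apply`): split every argument into its even and its odd part. -/
def homogeneousGlue {M N : Type v} [AddCommGroup M] [Module 𝕜 M] [AddCommGroup N] [Module 𝕜 N]
    (ℳ : ℤ → Submodule 𝕜 M) [DirectSum.Decomposition ℳ] {r : ℕ}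
    (F : (Fin r → ℤ) → MultilinearMap 𝕜 (fun _ : Fin r => M) N) :
    MultilinearMap 𝕜 (fun _ : Fin r => M) N :=
  ∑ e : Fin r → Fin 2,
    (F fun i => ((e i : ℕ) : ℤ)).compLinearMap fun i => parityProj ℳ (e i)

theorem homogeneousGlue_apply {M N : Type v} [AddCommGroup M] [Module 𝕜 M] [AddCommGroup N]
    [Module 𝕜 N] (ℳ : ℤ → Submodule 𝕜 M) [DirectSum.Decomposition ℳ] {r : ℕ}
    (F : (Fin r → ℤ) → MultilinearMap 𝕜 (fun _ : Fin r => M) N)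
    (hF : ∀ d d' : Fin r → ℤ, (∀ i, d i % 2 = d' i % 2) → F d = F d')
    (d : Fin r → ℤ) (v : Fin r → M) (hv : ∀ i, v i ∈ ℳ (d i)) :
    homogeneousGlue ℳ F v = F d v := by
  have hlt : ∀ i, (d i % 2).toNat < 2 := fun i => by omega
  rw [homogeneousGlue, sum_apply,
    Finset.sum_eq_single (fun i => (⟨(d i % 2).toNat, hlt i⟩ : Fin 2))]
  · rw [MultilinearMap.compLinearMap_apply, hF _ d (fun i => by simp; omega)]
    congr 1
    funext i
    rw [parityProj_of_mem ℳ _ (hv i), if_pos]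
    simp; omega
  · intro e _ he
    obtain ⟨i, hi⟩ := Function.ne_iff.mp he
    rw [MultilinearMap.compLinearMap_apply]
    refine MultilinearMap.map_coord_zero _ i ?_
    rw [parityProj_of_mem ℳ _ (hv i), if_neg]
    intro h
    exact hi (Fin.ext (by simp; omega))
  · simp

variable (𝒲 : ℤ → Submodule 𝕜 W) [DirectSum.Decomposition 𝒲]

/-- The circle product of a component `f` on `W^{⊗ (a+1)}` with a component `g` on
`W^{⊗ (b+1)}` of degree `n`. On homogeneous arguments `v_0, …, v_{a+b}` it is the sum over
`0 ≤ k ≤ a` and over the `(k, b)`-shuffles `σ` of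
`(-1)^{n (|v_{σ(0)}| + ⋯ + |v_{σ(k-1)}|)} ε(σ)` times
`f(v_{σ(0)}, …, v_{σ(k-1)}, g(v_{σ(k)}, …, v_{σ(k+b-1)}, v_{k+b}), v_{k+b+1}, …, v_{a+b})`. -/
def circComponent (n : ℤ) {a b : ℕ} (f : MultilinearMap 𝕜 (fun _ : Fin (a + 1) => W) W)
    (g : MultilinearMap 𝕜 (fun _ : Fin (b + 1) => W) W) :
    MultilinearMap 𝕜 (fun _ : Fin (a + b + 1) => W) W :=
  homogeneousGlue 𝒲 fun d =>
    ∑ k : Fin (a + 1), ∑ σ ∈ shuffles (a + b + 1) k b,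
      (sign 𝕜 (n * leadingDegree d σ k) * koszulSign 𝕜 d σ) •
        (insertAt f g k).domDomCongr σ

/-- The circle product `f ∘ g` for `g` of degree `n`. -/
def circ (n : ℤ) (f g : LeibnizCochain 𝕜 W) : LeibnizCochain 𝕜 W := fun s =>
  ∑ p ∈ (Finset.HasAntidiagonal.antidiagonal s).attach,
    (circComponent 𝒲 n (f p.1.1) (g p.1.2)).domDomCongr
      (finCongr (congrArg (· + 1) (Finset.HasAntidiagonal.mem_antidiagonal.mp p.2)))

/-- The graded Balavoine bracket of `f` of degree `m` and `g` of degree `n`. -/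
def balavoineBracket (m n : ℤ) (f g : LeibnizCochain 𝕜 W) : LeibnizCochain 𝕜 W :=
  circ 𝒲 n f g - sign 𝕜 (m * n) • circ 𝒲 m g f

end Balavoine

section GradedLie

variable {𝕜 : Type u} [Field 𝕜] {M : Type v} [AddCommGroup M] [Module 𝕜 M]

/-- The graded vector space with degree `n` part `L n`, together with the operations
`br m n : L m × L n → L (m + n)`, is a graded Lie algebra. -/
structure IsGradedLieAlgebra (L : ℤ → Submodule 𝕜 M) (br : ℤ → ℤ → M → M → M) : Prop where
  mem : ∀ m n, ∀ f ∈ L m, ∀ g ∈ L n, br m n f g ∈ L (m + n)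
  add_left : ∀ m n, ∀ f ∈ L m, ∀ f' ∈ L m, ∀ g ∈ L n,
    br m n (f + f') g = br m n f g + br m n f' g
  smul_left : ∀ m n, ∀ (c : 𝕜), ∀ f ∈ L m, ∀ g ∈ L n, br m n (c • f) g = c • br m n f g
  add_right : ∀ m n, ∀ f ∈ L m, ∀ g ∈ L n, ∀ g' ∈ L n,
    br m n f (g + g') = br m n f g + br m n f g'
  smul_right : ∀ m n, ∀ (c : 𝕜), ∀ f ∈ L m, ∀ g ∈ L n, br m n f (c • g) = c • br m n f g
  antisymm : ∀ m n, ∀ f ∈ L m, ∀ g ∈ L n, br m n f g = -(sign 𝕜 (m * n) • br n m g f)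
  jacobi : ∀ m n p, ∀ f ∈ L m, ∀ g ∈ L n, ∀ h ∈ L p,
    br m (n + p) f (br n p g h) =
      br (m + n) p (br m n f g) h + sign 𝕜 (m * n) • br n (m + p) g (br m p f h)

/-- `S` is a graded Lie subalgebra of the graded Lie algebra `(L, br)`. -/
structure IsGradedLieSubalgebra (L : ℤ → Submodule 𝕜 M) (br : ℤ → ℤ → M → M → M)
    (S : ℤ → Submodule 𝕜 M) : Prop where
  isGradedLieAlgebra : IsGradedLieAlgebra L br
  le : ∀ n, S n ≤ L n
  bracket_mem : ∀ m n, ∀ f ∈ S m, ∀ g ∈ S n, br m n f g ∈ S (m + n)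

/-- Maurer-Cartan elements: degree one elements `f` with `[f, f] = 0`. -/
def IsMaurerCartan (L : ℤ → Submodule 𝕜 M) (br : ℤ → ℤ → M → M → M) (f : M) : Prop :=
  f ∈ L 1 ∧ br 1 1 f f = 0

end GradedLie

section NambuCochains

variable {𝕜 : Type u} [Field 𝕜] {V : Type v} [AddCommGroup V] [Module 𝕜 V]

/-- Linear maps from `⊕_{p ≥ 1} (V ⊗ V)^{⊗ (p-1)} ⊗ V` to `V`, given by their components: the
entry at `a` is the component on `(V ⊗ V)^{⊗ a} ⊗ V`, curried in the last factor. -/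
abbrev NambuCochain (𝕜 : Type u) [Field 𝕜] (V : Type v) [AddCommGroup V] [Module 𝕜 V] :=
  (a : ℕ) → MultilinearMap 𝕜 (fun _ : Fin a => V ⊗[𝕜] V) (V →ₗ[𝕜] V)

/-- The degree `n` part: the component on `(V ⊗ V)^{⊗ a} ⊗ V` has degree `n + a`. -/
def CV (𝒱 : ℤ → Submodule 𝕜 V) (n : ℤ) : Submodule 𝕜 (NambuCochain 𝕜 V) where
  carrier := {f | ∀ (a : ℕ) (d : Fin a → ℤ) (c : ℤ) (X : Fin a → V ⊗[𝕜] V) (x : V),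
    (∀ i, X i ∈ tensorGrading 𝒱 (d i)) → x ∈ 𝒱 c → f a X x ∈ 𝒱 (∑ i, d i + c + (n + a))}
  zero_mem' := fun _ _ _ _ _ _ _ => Submodule.zero_mem _
  add_mem' := fun hf hg a d c X x hX hx =>
    Submodule.add_mem _ (hf a d c X x hX hx) (hg a d c X x hX hx)
  smul_mem' := fun r _ hf a d c X x hX hx => Submodule.smul_mem _ r (hf a d c X x hX hx)

variable (𝒱 : ℤ → Submodule 𝕜 V) [DirectSum.Decomposition 𝒱]

/-- For a component `φ` of degree `q`, the map that sends homogeneous `X_1, …, X_a` and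
`x ⊗ y` to `φ(X_1, …, X_a, x) ⊗ y + (-1)^{|x| (|X_1| + ⋯ + |X_a| + q)} x ⊗ φ(X_1, …, X_a, y)`,
see `leibnizExt_apply`. -/
def leibnizExt (q : ℤ) {a : ℕ} (φ : MultilinearMap 𝕜 (fun _ : Fin a => V ⊗[𝕜] V) (V →ₗ[𝕜] V)) :
    MultilinearMap 𝕜 (fun _ : Fin a => V ⊗[𝕜] V) (V ⊗[𝕜] V →ₗ[𝕜] V ⊗[𝕜] V) :=
  ((TensorProduct.mapBilinear (RingHom.id 𝕜) V V V V).flip LinearMap.id).compMultilinearMap φ +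
  homogeneousGlue (tensorGrading 𝒱) fun d =>
    ∑ c : Fin 2, sign 𝕜 (((c : ℕ) : ℤ) * (∑ i, d i + q)) •
      (TensorProduct.mapBilinear (RingHom.id 𝕜) V V V V (parityProj 𝒱 c)).compMultilinearMap φ

theorem sign_congr {m n : ℤ} (h : m % 2 = n % 2) : sign 𝕜 m = sign 𝕜 n := by
  unfold sign
  simp only [Int.even_iff, h]

theorem leibnizExt_apply (q : ℤ) {a : ℕ}
    (φ : MultilinearMap 𝕜 (fun _ : Fin a => V ⊗[𝕜] V) (V →ₗ[𝕜] V)) (d : Fin a → ℤ) (c : ℤ)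
    (X : Fin a → V ⊗[𝕜] V) (x y : V) (hX : ∀ i, X i ∈ tensorGrading 𝒱 (d i)) (hx : x ∈ 𝒱 c) :
    leibnizExt 𝒱 q φ X (x ⊗ₜ[𝕜] y) =
      φ X x ⊗ₜ[𝕜] y + sign 𝕜 (c * (∑ i, d i + q)) • x ⊗ₜ[𝕜] φ X y := by
  rw [leibnizExt, add_apply, homogeneousGlue_apply (d := d) (hv := hX)]
  · simp only [LinearMap.compMultilinearMap_apply, LinearMap.add_apply, LinearMap.flip_apply,
      Fin.sum_univ_two, add_apply, smul_apply,
      LinearMap.smul_apply, TensorProduct.mapBilinear_apply, TensorProduct.map_tmul,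
      parityProj_of_mem 𝒱 _ hx, LinearMap.id_apply]
    congr 1
    rcases Int.even_or_odd c with h | h
    · have h0 : c % 2 = 0 := Int.even_iff.mp h
      simp [h0, sign, h.mul_right]
    · have h1 : c % 2 = 1 := Int.odd_iff.mp h
      rw [sign_congr (𝕜 := 𝕜) (m := c * (∑ i, d i + q)) (n := ∑ i, d i + q)]
      · simp [h1]
      · rw [Int.mul_emod, h1]; simp
  · intro d d' h
    refine Finset.sum_congr rfl fun c _ => ?_
    congr 1
    refine sign_congr ?_
    have hs : (∑ i, d i) % 2 = (∑ i, d' i) % 2 := by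
      rw [Finset.sum_int_mod, Finset.sum_int_mod (f := d')]
      simp only [h]
    refine Int.ModEq.mul_left _ (Int.ModEq.add_right _ hs)

theorem leibnizExt_add (q : ℤ) {a : ℕ}
    (φ ψ : MultilinearMap 𝕜 (fun _ : Fin a => V ⊗[𝕜] V) (V →ₗ[𝕜] V)) :
    leibnizExt 𝒱 q (φ + ψ) = leibnizExt 𝒱 q φ + leibnizExt 𝒱 q ψ := by
  ext X : 1
  simp only [leibnizExt, homogeneousGlue, add_apply, sum_apply,
    MultilinearMap.compLinearMap_apply, smul_apply,
    LinearMap.compMultilinearMap_apply, map_add, smul_add, Finset.sum_add_distrib]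
  abel

theorem leibnizExt_smul (q : ℤ) {a : ℕ} (r : 𝕜)
    (φ : MultilinearMap 𝕜 (fun _ : Fin a => V ⊗[𝕜] V) (V →ₗ[𝕜] V)) :
    leibnizExt 𝒱 q (r • φ) = r • leibnizExt 𝒱 q φ := by
  ext X : 1
  simp only [leibnizExt, homogeneousGlue, add_apply, sum_apply,
    MultilinearMap.compLinearMap_apply, smul_apply,
    LinearMap.compMultilinearMap_apply, map_smul, smul_add, Finset.smul_sum]
  simp only [smul_comm r]

/-- The map `Ψ` in degree `n`: the component on `(V ⊗ V)^{⊗ (p-1)} ⊗ V`, of degree `n + p - 1`,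
is sent to `(-1)^{p(p-1)/2}` times its extension to `(s(V ⊗ V))^{⊗ p}`; here `p = a + 1`. -/
def Psi (n : ℤ) : NambuCochain 𝕜 V →ₗ[𝕜] LeibnizCochain 𝕜 (V ⊗[𝕜] V) where
  toFun f := fun a => sign 𝕜 (((a + 1) * a / 2 : ℕ) : ℤ) •
    (leibnizExt 𝒱 (n + a) (f a)).uncurryRight
  map_add' f g := by
    funext a
    ext v
    simp [leibnizExt_add]
  map_smul' r f := by
    funext a
    ext v
    simp only [Pi.smul_apply, leibnizExt_smul, smul_apply,
      MultilinearMap.uncurryRight_apply, LinearMap.smul_apply, RingHom.id_apply]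
    rw [smul_comm]

/-- The grading of `s(V ⊗ V)`. -/
abbrev suspTensor (𝒱 : ℤ → Submodule 𝕜 V) : ℤ → Submodule 𝕜 (V ⊗[𝕜] V) :=
  suspension (tensorGrading 𝒱)

/-- The transported bracket `Ψ⁻¹ [Ψ f, Ψ g]` of `f` of degree `m` and `g` of degree `n`. -/
def courant (m n : ℤ) (f g : NambuCochain 𝕜 V) : NambuCochain 𝕜 V :=
  Function.invFunOn (Psi 𝒱 (m + n)) (CV 𝒱 (m + n))
    (balavoineBracket (suspTensor 𝒱) m n (Psi 𝒱 m f) (Psi 𝒱 n g))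

/-- The contribution of the components `f`, on `(V ⊗ V)^{⊗ a} ⊗ V`, and `g`, on
`(V ⊗ V)^{⊗ b} ⊗ V`, of cochains of which the second has degree `n`, to the circle product,
evaluated on homogeneous `X_0, …, X_{a+b-1}` of degrees `d` in `V ⊗ V` and on `x`. All signs are
formed with the degrees `d i + 1` of the suspended vectors `s X_i`. -/
def nambuCircComponent (n : ℤ) {a b : ℕ}
    (f : MultilinearMap 𝕜 (fun _ : Fin a => V ⊗[𝕜] V) (V →ₗ[𝕜] V))
    (g : MultilinearMap 𝕜 (fun _ : Fin b => V ⊗[𝕜] V) (V →ₗ[𝕜] V))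
    (d : Fin (a + b) → ℤ) (X : Fin (a + b) → V ⊗[𝕜] V) (x : V) : V :=
  sign 𝕜 (a * b) •
    ((∑ k : Fin a, ∑ σ ∈ shuffles (a + b) k b,
        (sign 𝕜 (n * leadingDegree (fun i => d i + 1) σ k) *
            koszulSign 𝕜 (fun i => d i + 1) σ) •
          f (fun t =>
              if (t : ℕ) < k then X (σ ⟨t, by omega⟩)
              else if t = k then
                leibnizExt 𝒱 (n + b) g (fun r => X (σ ⟨k + r, by omega⟩)) (X ⟨k + b, by omega⟩)
              else X ⟨t + b, by omega⟩) x) +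
      ∑ σ ∈ shuffles (a + b) a b,
        (sign 𝕜 (n * leadingDegree (fun i => d i + 1) σ a) *
            koszulSign 𝕜 (fun i => d i + 1) σ) •
          f (fun t => X (σ ⟨t, by omega⟩)) (g (fun r => X (σ ⟨a + r, by omega⟩)) x))

/-- The value of the circle product `f ∘ g`, with `g` of degree `n`, on homogeneous
`X_0, …, X_{s-1}` of degrees `d` in `V ⊗ V` and on `x`. -/
def nambuCirc (n : ℤ) (f g : NambuCochain 𝕜 V) (s : ℕ) (d : Fin s → ℤ)
    (X : Fin s → V ⊗[𝕜] V) (x : V) : V :=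
  ∑ p ∈ (Finset.HasAntidiagonal.antidiagonal s).attach,
    nambuCircComponent 𝒱 n (f p.1.1) (g p.1.2)
      (fun i => d (Fin.cast (Finset.HasAntidiagonal.mem_antidiagonal.mp p.2) i))
      (fun i => X (Fin.cast (Finset.HasAntidiagonal.mem_antidiagonal.mp p.2) i)) x

/-- A homotopy Nambu algebra structure on `V`: maps `O a : (V ⊗ V)^{⊗ a} ⊗ V → V` of degree
`a + 1` for `a ≥ 0` that satisfy the identities `O ∘ O = 0` on all homogeneous arguments. -/
structure IsHomotopyNambu (O : NambuCochain 𝕜 V) : Prop where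
  degree : ∀ (a : ℕ) (d : Fin a → ℤ) (c : ℤ) (X : Fin a → V ⊗[𝕜] V) (x : V),
    (∀ i, X i ∈ tensorGrading 𝒱 (d i)) → x ∈ 𝒱 c → O a X x ∈ 𝒱 (∑ i, d i + c + (a + 1))
  identity : ∀ (s : ℕ) (d : Fin s → ℤ) (X : Fin s → V ⊗[𝕜] V) (x : V),
    (∀ i, X i ∈ tensorGrading 𝒱 (d i)) → nambuCirc 𝒱 1 O O s d X x = 0

end NambuCochains

end Nambu

end

/-! The graded Lie structure on `CLV` comes from one fact: right multiplication `f ↦ f ∘ g` for the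
Balavoine product turns the bracket into a graded commutator of operators, up to sign
(`lcirc_commutator`). Jacobi is then formal, because all double brackets become combinations of
left-nested products (`lbracket_jacobi`).

Shuffle sums are awkward for such identities, so cochains are treated as functions of words of
letters (degree, vector), and the product is defined by recursion on the first letter. That letter
goes to the front of `f`, enters `g` as a further argument, or closes `g` as its last argument,
after which the rest of the word stays in place. A partially applied `g` has its degree raised by
that of the letter, and this accounts for all Koszul signs. Splitting shuffles by the place of their
smallest index gives the same recursion for the explicit sums (`lcirc_ofFn`, `lconv_ofFn`).

For `Ψ`, freeze the arguments in `V ⊗ V`. A Nambu cochain then gives an endomorphism `φ` of `V`, and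
`Ψ` replaces it, up to sign, by its extension `D φ` to a graded derivation on `V ⊗ V`
(`psiEval_eq_derExt`). Separating the last letter (`lcirc_concat`) splits the product of two such
cochains into the terms where the inner one is closed earlier, and a shuffle convolution that
composes the endomorphism values. `D` is linear, which handles the former (`lcirc_map`), and `D`
preserves graded commutators, which handles the latter after antisymmetrization
(`derExt_commutator`, `lconv_commutator`). Hence `[Ψ f, Ψ g]` is `D` of an explicit function of
words (`wordEval_balavoineBracket_Psi`). This gives both the closure of the image and the formula
for the transported bracket.

Injectivity of `Ψ` is that of `D` on homogeneous endomorphisms: evaluation on `x ⊗ x` suffices when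
`2 ≠ 0` (`eq_zero_of_derExt_eq_zero`). For `O` of degree one the bracket of `O` with itself is `2 (O
∘ O)`, whence the description of Maurer–Cartan elements. -/

set_option linter.unusedSectionVars false

noncomputable section

namespace Nambu

universe u v

/-! ### Recursive products on functions of words -/

section Words

variable (𝕜 : Type*) [Field 𝕜]

theorem sign_zero : sign 𝕜 0 = 1 := by simp [sign]

theorem sign_add (m n : ℤ) : sign 𝕜 (m + n) = sign 𝕜 m * sign 𝕜 n := by
  unfold sign
  by_cases hm : Even m <;> by_cases hn : Even n <;> simp [hm, hn, Int.even_add]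

theorem sign_eq_one_or (n : ℤ) : sign 𝕜 n = 1 ∨ sign 𝕜 n = -1 := by
  unfold sign
  split_ifs <;> simp

theorem sign_mul_self (n : ℤ) : sign 𝕜 n * sign 𝕜 n = 1 := by
  rcases sign_eq_one_or 𝕜 n with h | h <;> simp [h]

variable {W M A : Type*} [AddCommGroup W] [Module 𝕜 W] [AddCommGroup M] [Module 𝕜 M]
  [Ring A] [Algebra 𝕜 A]

/-- The circle product on functions of words of vectors with given degrees; `n` is the degree
of `g`. -/
def lcirc : ℤ → (List (ℤ × W) → W) → (List (ℤ × W) → M) → List (ℤ × W) → M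
  | _, _, _, [] => 0
  | n, g, f, v :: l => sign 𝕜 (n * v.1) • lcirc n g (fun w => f (v :: w)) l +
      lcirc (n + v.1) (fun w => g (v :: w)) f l + f ((v.1 + n, g [v]) :: l)

/-- The shuffle convolution product on functions of words; `n` is the degree of `g`. -/
def lconv : ℤ → (List (ℤ × W) → A) → (List (ℤ × W) → A) → List (ℤ × W) → A
  | _, f, g, [] => f [] * g []
  | n, f, g, v :: l => sign 𝕜 (n * v.1) • lconv n (fun w => f (v :: w)) g l +
      lconv (n + v.1) f (fun w => g (v :: w)) l

/-- Linearity in every letter of a word. -/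
structure WordLinear (f : List (ℤ × W) → M) : Prop where
  add : ∀ u d x y w, f (u ++ (d, x + y) :: w) = f (u ++ (d, x) :: w) + f (u ++ (d, y) :: w)
  smul : ∀ u d (c : 𝕜) x w, f (u ++ (d, c • x) :: w) = c • f (u ++ (d, x) :: w)

variable {𝕜}

theorem lcirc_cons (n : ℤ) (g : List (ℤ × W) → W) (f : List (ℤ × W) → M) (v : ℤ × W)
    (l : List (ℤ × W)) :
    lcirc 𝕜 n g f (v :: l) = sign 𝕜 (n * v.1) • lcirc 𝕜 n g (fun w => f (v :: w)) l +
      lcirc 𝕜 (n + v.1) (fun w => g (v :: w)) f l + f ((v.1 + n, g [v]) :: l) := by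
  rw [lcirc]

theorem WordLinear.cons {f : List (ℤ × W) → M} (hf : WordLinear 𝕜 f) (v : ℤ × W) :
    WordLinear 𝕜 fun w => f (v :: w) :=
  ⟨fun u => hf.add (v :: u), fun u => hf.smul (v :: u)⟩

theorem lcirc_add (n : ℤ) (g : List (ℤ × W) → W) (f f' : List (ℤ × W) → M) (l : List (ℤ × W)) :
    lcirc 𝕜 n g (f + f') l = lcirc 𝕜 n g f l + lcirc 𝕜 n g f' l := by
  induction l generalizing n g f f' with
  | nil => simp [lcirc]
  | cons v l ih =>
    have := ih n g (fun w => f (v :: w)) (fun w => f' (v :: w))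
    simp only [lcirc, ih, Pi.add_apply] at this ⊢
    rw [show (fun w => f (v :: w) + f' (v :: w)) =
      (fun w => f (v :: w)) + fun w => f' (v :: w) from rfl, ih]
    module

theorem lcirc_smul (n : ℤ) (g : List (ℤ × W) → W) (c : 𝕜) (f : List (ℤ × W) → M)
    (l : List (ℤ × W)) : lcirc 𝕜 n g (c • f) l = c • lcirc 𝕜 n g f l := by
  induction l generalizing n g f with
  | nil => simp [lcirc]
  | cons v l ih =>
    simp only [lcirc, ih, Pi.smul_apply]
    rw [show (fun w => c • f (v :: w)) = c • (fun w => f (v :: w)) from rfl, ih]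
    module

theorem lcirc_sub_smul (n : ℤ) (g : List (ℤ × W) → W) (c : 𝕜) (f f' : List (ℤ × W) → M)
    (l : List (ℤ × W)) :
    lcirc 𝕜 n g (f - c • f') l = lcirc 𝕜 n g f l - c • lcirc 𝕜 n g f' l := by
  rw [sub_eq_add_neg, ← neg_smul, lcirc_add, lcirc_smul]
  module

/-- The value of `g` becomes a letter for `f`. This is why, in contrast to additivity in `f`,
letter-wise linearity of `f` is needed. -/
theorem lcirc_add_left {f : List (ℤ × W) → M} (hf : WordLinear 𝕜 f) (n : ℤ)
    (g g' : List (ℤ × W) → W) (l : List (ℤ × W)) :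
    lcirc 𝕜 n (g + g') f l = lcirc 𝕜 n g f l + lcirc 𝕜 n g' f l := by
  induction l generalizing n g g' f with
  | nil => simp [lcirc]
  | cons v l ih =>
    simp only [lcirc, ih (hf.cons v), Pi.add_apply]
    rw [show (fun w => g (v :: w) + g' (v :: w)) =
      (fun w => g (v :: w)) + fun w => g' (v :: w) from rfl, ih hf]
    have := hf.add [] (v.1 + n) (g [v]) (g' [v]) l
    simp only [List.nil_append] at this
    rw [this]
    module

theorem lcirc_smul_left {f : List (ℤ × W) → M} (hf : WordLinear 𝕜 f) (n : ℤ) (c : 𝕜)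
    (g : List (ℤ × W) → W) (l : List (ℤ × W)) :
    lcirc 𝕜 n (c • g) f l = c • lcirc 𝕜 n g f l := by
  induction l generalizing n g f with
  | nil => simp [lcirc]
  | cons v l ih =>
    simp only [lcirc, ih (hf.cons v), Pi.smul_apply]
    rw [show (fun w => c • g (v :: w)) = c • (fun w => g (v :: w)) from rfl, ih hf]
    have := hf.smul [] (v.1 + n) c (g [v]) l
    simp only [List.nil_append] at this
    rw [this]
    module

theorem WordLinear.lcirc {f : List (ℤ × W) → M} {g : List (ℤ × W) → W} (hf : WordLinear 𝕜 f)
    (hg : WordLinear 𝕜 g) (n : ℤ) : WordLinear 𝕜 (lcirc 𝕜 n g f) where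
  add u := by
    induction u generalizing n f g with
    | nil =>
      intro d x y w
      simp only [List.nil_append, Nambu.lcirc]
      have h1 : (fun w => f ((d, x + y) :: w)) =
        (fun w => f ((d, x) :: w)) + fun w => f ((d, y) :: w) := funext (hf.add [] d x y)
      have h2 : (fun w => g ((d, x + y) :: w)) =
        (fun w => g ((d, x) :: w)) + fun w => g ((d, y) :: w) := funext (hg.add [] d x y)
      have h3 : g [(d, x + y)] = g [(d, x)] + g [(d, y)] := hg.add [] d x y []
      have h4 := hf.add [] (d + n) (g [(d, x)]) (g [(d, y)]) w
      simp only [List.nil_append] at h4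
      rw [h1, h2, h3, h4, lcirc_add, lcirc_add_left hf]
      module
    | cons v u ih =>
      intro d x y w
      have h4 := hf.add ((v.1 + n, g [v]) :: u) d x y w
      simp only [List.cons_append, Nambu.lcirc, ih (hf.cons v) hg, ih hf (hg.cons v)] at h4 ⊢
      rw [h4]
      module
  smul u := by
    induction u generalizing n f g with
    | nil =>
      intro d c x w
      simp only [List.nil_append, Nambu.lcirc]
      have h1 : (fun w => f ((d, c • x) :: w)) =
        c • fun w => f ((d, x) :: w) := funext (hf.smul [] d c x)
      have h2 : (fun w => g ((d, c • x) :: w)) =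
        c • fun w => g ((d, x) :: w) := funext (hg.smul [] d c x)
      have h3 : g [(d, c • x)] = c • g [(d, x)] := hg.smul [] d c x []
      have h4 := hf.smul [] (d + n) c (g [(d, x)]) w
      simp only [List.nil_append] at h4
      rw [h1, h2, h3, h4, lcirc_smul, lcirc_smul_left hf]
      module
    | cons v u ih =>
      intro d c x w
      have h4 := hf.smul ((v.1 + n, g [v]) :: u) d c x w
      simp only [List.cons_append, Nambu.lcirc, ih (hf.cons v) hg, ih hf (hg.cons v)] at h4 ⊢
      rw [h4]
      module

theorem WordLinear.add_fun {f g : List (ℤ × W) → M} (hf : WordLinear 𝕜 f)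
    (hg : WordLinear 𝕜 g) : WordLinear 𝕜 (f + g) :=
  ⟨fun u d x y w => by simp only [Pi.add_apply, hf.add, hg.add]; abel,
   fun u d c x w => by simp only [Pi.add_apply, hf.smul, hg.smul, smul_add]⟩

theorem WordLinear.smul_fun {f : List (ℤ × W) → M} (hf : WordLinear 𝕜 f) (c : 𝕜) :
    WordLinear 𝕜 (c • f) :=
  ⟨fun u d x y w => by simp only [Pi.smul_apply, hf.add, smul_add],
   fun u d c x w => by simp only [Pi.smul_apply, hf.smul]; rw [smul_comm]⟩

/-- The letter-wise form of the statement that the commutator of two coderivations is the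
coderivation of the commutator. -/
theorem lcirc_commutator {f : List (ℤ × W) → M} (hf : WordLinear 𝕜 f) (n p : ℤ)
    (g h : List (ℤ × W) → W) (l : List (ℤ × W)) :
    lcirc 𝕜 (n + p) (lcirc 𝕜 p h g - sign 𝕜 (n * p) • lcirc 𝕜 n g h) f l =
      lcirc 𝕜 p h (lcirc 𝕜 n g f) l - sign 𝕜 (n * p) • lcirc 𝕜 n g (lcirc 𝕜 p h f) l := by
  induction l generalizing n p g h f with
  | nil => simp [lcirc]
  | cons v l ih =>
    obtain ⟨d, v⟩ := v
    -- The three instances of the induction hypothesis belong to the three functions that can absorb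
    -- the first letter: `f`, `g` and `h`.
    have e1 := ih (hf.cons (d, v)) n p g h
    have e2 := ih hf (n + d) p (fun w => g ((d, v) :: w)) h
    have e3 := ih hf n (p + d) g (fun w => h ((d, v) :: w))
    have c1 : ∀ (n : ℤ) (g : List (ℤ × W) → W) (f : List (ℤ × W) → M),
        (fun w => lcirc 𝕜 n g f ((d, v) :: w)) =
        sign 𝕜 (n * d) • lcirc 𝕜 n g (fun w => f ((d, v) :: w)) +
        (lcirc 𝕜 (n + d) (fun w => g ((d, v) :: w)) f + fun w => f ((d + n, g [(d, v)]) :: w)) :=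
      fun n g f => funext fun w => by simp only [lcirc, Pi.add_apply, Pi.smul_apply, add_assoc]
    -- The bracket of `g` and `h` with its first letter fixed: two brackets with a partially applied
    -- entry, of degree raised by `d`, and the two terms in which the letter closes the inner
    -- function.
    have c2 : (fun w => (lcirc 𝕜 p h g - sign 𝕜 (n * p) • lcirc 𝕜 n g h) ((d, v) :: w)) =
        sign 𝕜 (p * d) • (lcirc 𝕜 p h (fun w => g ((d, v) :: w)) - sign 𝕜 ((n + d) * p) •
          lcirc 𝕜 (n + d) (fun w => g ((d, v) :: w)) h) +
        ((lcirc 𝕜 (p + d) (fun w => h ((d, v) :: w)) g - sign 𝕜 (n * (p + d)) •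
          lcirc 𝕜 n g (fun w => h ((d, v) :: w))) +
        ((fun w => g ((d + p, h [(d, v)]) :: w)) +
          (-sign 𝕜 (n * p)) • (fun w => h ((d + n, g [(d, v)]) :: w)))) := by
      funext w
      simp only [lcirc, Pi.add_apply, Pi.smul_apply, Pi.sub_apply, mul_add, add_mul, sign_add,
        mul_comm d]
      rcases sign_eq_one_or 𝕜 (n * p) with h1 | h1 <;>
      rcases sign_eq_one_or 𝕜 (p * d) with h2 | h2 <;>
      rcases sign_eq_one_or 𝕜 (n * d) with h3 | h3 <;>
      simp only [h1, h2, h3] <;> module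
    have c3 : (lcirc 𝕜 p h g - sign 𝕜 (n * p) • lcirc 𝕜 n g h) [(d, v)] =
        g [(d + p, h [(d, v)])] + (-sign 𝕜 (n * p)) • h [(d + n, g [(d, v)])] := by
      simp only [lcirc, Pi.smul_apply, Pi.sub_apply]
      module
    have a1 := hf.add [] (d + (n + p)) (g [(d + p, h [(d, v)])])
      ((-sign 𝕜 (n * p)) • h [(d + n, g [(d, v)])]) l
    have a2 := hf.smul [] (d + (n + p)) (-sign 𝕜 (n * p)) (h [(d + n, g [(d, v)])]) l
    simp only [List.nil_append] at a1 a2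
    rw [lcirc, c2, c3, a1, a2, lcirc_add_left hf, lcirc_add_left hf, lcirc_add_left hf,
      lcirc_smul_left hf, lcirc_smul_left hf, e1, add_right_comm n p d, e2,
      add_right_comm n d p, add_assoc n p d, e3]
    conv_rhs => rw [lcirc_cons p h, lcirc_cons n g (lcirc 𝕜 p h f), c1 n g f, c1 p h f]
    simp only [lcirc_add, lcirc_smul, lcirc]
    rw [show d + p + n = d + (n + p) by ring, show d + n + p = d + (n + p) by ring,
      show n + (d + p) = n + (p + d) by ring, show p + (d + n) = n + (p + d) by ring]
    simp only [mul_add, add_mul, sign_add, mul_comm d, mul_comm p n]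
    -- All signs are products of the three signs with exponents `n * p`, `p * d`, `n * d`; for each
    -- choice of their values a linear identity is left.
    rcases sign_eq_one_or 𝕜 (n * p) with h1 | h1 <;>
    rcases sign_eq_one_or 𝕜 (p * d) with h2 | h2 <;>
    rcases sign_eq_one_or 𝕜 (n * d) with h3 | h3 <;>
    simp only [h1, h2, h3] <;> module

variable (𝕜) in
/-- The graded bracket on functions of words, for `f` of degree `m` and `g` of degree `n`. -/
def lbracket (m n : ℤ) (f g : List (ℤ × W) → W) : List (ℤ × W) → W :=
  lcirc 𝕜 n g f - sign 𝕜 (m * n) • lcirc 𝕜 m f g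

/-- Products by a bracket on the right are rewritten by `lcirc_commutator`. Only left-nested
products `(x ∘ y) ∘ z` of permutations of `f`, `g`, `h` remain, and their coefficients agree. -/
theorem lbracket_jacobi {f g h : List (ℤ × W) → W} (hf : WordLinear 𝕜 f) (hg : WordLinear 𝕜 g)
    (hh : WordLinear 𝕜 h) (m n p : ℤ) (l : List (ℤ × W)) :
    lbracket 𝕜 m (n + p) f (lbracket 𝕜 n p g h) l =
      lbracket 𝕜 (m + n) p (lbracket 𝕜 m n f g) h l +
        sign 𝕜 (m * n) • lbracket 𝕜 n (m + p) g (lbracket 𝕜 m p f h) l := by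
  simp only [lbracket, Pi.sub_apply, Pi.smul_apply, lcirc_commutator hf, lcirc_commutator hg,
    lcirc_commutator hh, lcirc_sub_smul, mul_add, add_mul, sign_add, mul_comm n m]
  rcases sign_eq_one_or 𝕜 (m * n) with h1 | h1 <;>
  rcases sign_eq_one_or 𝕜 (m * p) with h2 | h2 <;>
  rcases sign_eq_one_or 𝕜 (n * p) with h3 | h3 <;>
  simp only [h1, h2, h3] <;> module

/-! ### Homogeneous words and degrees -/

/-- The total degree of a word. -/
def wordDegree (l : List (ℤ × W)) : ℤ := (l.map Prod.fst).sum

@[simp] theorem wordDegree_nil : wordDegree ([] : List (ℤ × W)) = 0 := rfl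

@[simp] theorem wordDegree_cons (v : ℤ × W) (l : List (ℤ × W)) :
    wordDegree (v :: l) = v.1 + wordDegree l := by simp [wordDegree]

/-- The relation between letters is left general because two cases are needed: equality of
homogeneous letters, and equality of vectors with degrees of the same parity. The product evaluates
`g` on nonempty words only. -/
theorem lcirc_congr {P : ℤ × W → ℤ × W → Prop} (hP : ∀ v v', P v v' → v.1 % 2 = v'.1 % 2)
    {n n' : ℤ} (hn : n % 2 = n' % 2) {g g' : List (ℤ × W) → W} {f f' : List (ℤ × W) → M}
    (hf : ∀ l l', List.Forall₂ P l l' → f l = f' l')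
    (hg : ∀ l l', l ≠ [] → List.Forall₂ P l l' →
      P (wordDegree l + n, g l) (wordDegree l' + n', g' l'))
    {l l' : List (ℤ × W)} (hl : List.Forall₂ P l l') :
    lcirc 𝕜 n g f l = lcirc 𝕜 n' g' f' l' := by
  induction hl generalizing n n' g g' f f' with
  | nil => simp [lcirc]
  | @cons v v' l l' hv hl ih =>
    have hd := hP _ _ hv
    rw [lcirc, lcirc, sign_congr (𝕜 := 𝕜) (Int.ModEq.mul hn hd),
      ih hn (fun w w' hw => hf _ _ (.cons hv hw)) hg,
      ih (Int.ModEq.add hn hd) hf (fun w w' _ hw => ?_)]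
    · congr 1
      refine hf _ _ (.cons ?_ hl)
      simpa using hg [v] [v'] (by simp) (.cons hv .nil)
    · have := hg (v :: w) (v' :: w') (by simp) (.cons hv hw)
      convert this using 2 <;> simp <;> ring

theorem lconv_congr {P : ℤ × W → ℤ × W → Prop} (hP : ∀ v v', P v v' → v.1 % 2 = v'.1 % 2)
    {n n' : ℤ} (hn : n % 2 = n' % 2) {g g' f f' : List (ℤ × W) → A}
    (hf : ∀ l l', List.Forall₂ P l l' → f l = f' l')
    (hg : ∀ l l', List.Forall₂ P l l' → g l = g' l')
    {l l' : List (ℤ × W)} (hl : List.Forall₂ P l l') :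
    lconv 𝕜 n f g l = lconv 𝕜 n' f' g' l' := by
  induction hl generalizing n n' g g' f f' with
  | nil => simp [lconv, hf _ _ .nil, hg _ _ .nil]
  | @cons v v' l l' hv hl ih =>
    have hd := hP _ _ hv
    rw [lconv, lconv, sign_congr (𝕜 := 𝕜) (Int.ModEq.mul hn hd),
      ih hn (fun w w' hw => hf _ _ (.cons hv hw)) hg,
      ih (Int.ModEq.add hn hd) hf (fun w w' hw => hg _ _ (.cons hv hw))]

/-- Words of homogeneous vectors of the given degrees. -/
def IsHomWord (𝒲 : ℤ → Submodule 𝕜 W) (l : List (ℤ × W)) : Prop := ∀ v ∈ l, v.2 ∈ 𝒲 v.1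

theorem IsHomWord.forall₂ {𝒲 : ℤ → Submodule 𝕜 W} {l : List (ℤ × W)} (h : IsHomWord 𝒲 l) :
    List.Forall₂ (fun v v' => v = v' ∧ v.2 ∈ 𝒲 v.1) l l := by
  induction l with
  | nil => exact .nil
  | cons v l ih =>
    exact .cons ⟨rfl, h v (by simp)⟩ (ih fun w hw => h w (by simp [hw]))

theorem isHomWord_of_forall₂ {𝒲 : ℤ → Submodule 𝕜 W} {l l' : List (ℤ × W)}
    (h : List.Forall₂ (fun v v' => v = v' ∧ v.2 ∈ 𝒲 v.1) l l') : l = l' ∧ IsHomWord 𝒲 l := by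
  induction h with
  | nil => exact ⟨rfl, by simp [IsHomWord]⟩
  | cons h _ ih =>
    obtain ⟨rfl, h⟩ := h
    obtain ⟨rfl, h'⟩ := ih
    exact ⟨rfl, fun w hw => by
      rcases List.mem_cons.1 hw with rfl | hw
      exacts [h, h' w hw]⟩

theorem lcirc_congr_hom {𝒲 : ℤ → Submodule 𝕜 W} {n : ℤ} {g g' : List (ℤ × W) → W}
    {f f' : List (ℤ × W) → M} (hf : ∀ l, IsHomWord 𝒲 l → f l = f' l)
    (hg : ∀ l, l ≠ [] → IsHomWord 𝒲 l → g l = g' l ∧ g l ∈ 𝒲 (wordDegree l + n))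
    {l : List (ℤ × W)} (hl : IsHomWord 𝒲 l) : lcirc 𝕜 n g f l = lcirc 𝕜 n g' f' l := by
  refine lcirc_congr (P := fun v v' => v = v' ∧ v.2 ∈ 𝒲 v.1) (fun v v' h => by rw [h.1]) rfl
    (fun l l' h => ?_) (fun l l' h0 h => ?_) hl.forall₂
  · obtain ⟨rfl, h'⟩ := isHomWord_of_forall₂ h
    exact hf l h'
  · obtain ⟨rfl, h'⟩ := isHomWord_of_forall₂ h
    exact ⟨by rw [(hg l h0 h').1], (hg l h0 h').2⟩

/-- The degree condition on functions of words. -/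
def HasWordDegree (𝒲 : ℤ → Submodule 𝕜 W) (ℳ : ℤ → Submodule 𝕜 M) (n : ℤ)
    (g : List (ℤ × W) → M) : Prop :=
  ∀ l, IsHomWord 𝒲 l → g l ∈ ℳ (wordDegree l + n)

theorem isHomWord_cons {𝒲 : ℤ → Submodule 𝕜 W} {v : ℤ × W} {l : List (ℤ × W)} :
    IsHomWord 𝒲 (v :: l) ↔ v.2 ∈ 𝒲 v.1 ∧ IsHomWord 𝒲 l := by simp [IsHomWord]

theorem HasWordDegree.cons {𝒲 : ℤ → Submodule 𝕜 W} {ℳ : ℤ → Submodule 𝕜 M} {n : ℤ}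
    {g : List (ℤ × W) → M} (hg : HasWordDegree 𝒲 ℳ n g) {v : ℤ × W} (hv : v.2 ∈ 𝒲 v.1) :
    HasWordDegree 𝒲 ℳ (n + v.1) fun w => g (v :: w) := fun l hl => by
  have := hg (v :: l) (isHomWord_cons.2 ⟨hv, hl⟩)
  rwa [wordDegree_cons, show v.1 + wordDegree l + n = wordDegree l + (n + v.1) by ring] at this

theorem HasWordDegree.singleton {𝒲 : ℤ → Submodule 𝕜 W} {n : ℤ} {g : List (ℤ × W) → W}
    (hg : HasWordDegree 𝒲 𝒲 n g) {v : ℤ × W} (hv : v.2 ∈ 𝒲 v.1) : g [v] ∈ 𝒲 (v.1 + n) := by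
  simpa using hg [v] (by simpa [IsHomWord] using hv)

theorem HasWordDegree.lcirc {𝒲 : ℤ → Submodule 𝕜 W} {ℳ : ℤ → Submodule 𝕜 M} {m n : ℤ}
    {f : List (ℤ × W) → M} {g : List (ℤ × W) → W} (hf : HasWordDegree 𝒲 ℳ m f)
    (hg : HasWordDegree 𝒲 𝒲 n g) : HasWordDegree 𝒲 ℳ (m + n) (lcirc 𝕜 n g f) := by
  intro l
  induction l generalizing m n f g with
  | nil => intro _; exact Submodule.zero_mem _
  | cons v l ih =>
    intro hl
    obtain ⟨hv, hl⟩ := isHomWord_cons.1 hl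
    have h1 := ih (hf.cons hv) hg hl
    have h2 := ih hf (hg.cons hv) hl
    have h3 := hf ((v.1 + n, g [v]) :: l) (isHomWord_cons.2 ⟨hg.singleton hv, hl⟩)
    rw [show wordDegree l + (m + v.1 + n) = wordDegree (v :: l) + (m + n) by simp; ring] at h1
    rw [show wordDegree l + (m + (n + v.1)) = wordDegree (v :: l) + (m + n) by simp; ring] at h2
    rw [show wordDegree ((v.1 + n, g [v]) :: l) + m = wordDegree (v :: l) + (m + n) by
      simp; ring] at h3
    exact Submodule.add_mem _ (Submodule.add_mem _ (Submodule.smul_mem _ _ h1) h2) h3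

theorem HasWordDegree.lconv {𝒲 : ℤ → Submodule 𝕜 W} {ℳ : ℤ → Submodule 𝕜 A}
    (hℳ : ∀ i j, ∀ a ∈ ℳ i, ∀ b ∈ ℳ j, a * b ∈ ℳ (i + j)) {m n : ℤ}
    {f g : List (ℤ × W) → A} (hf : HasWordDegree 𝒲 ℳ m f)
    (hg : HasWordDegree 𝒲 ℳ n g) : HasWordDegree 𝒲 ℳ (m + n) (lconv 𝕜 n f g) := by
  intro l
  induction l generalizing m n f g with
  | nil =>
    intro h
    have := hℳ _ _ _ (hf [] h) _ (hg [] h)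
    simpa [Nambu.lconv] using this
  | cons v l ih =>
    intro hl
    obtain ⟨hv, hl⟩ := isHomWord_cons.1 hl
    have h1 := ih (hf.cons hv) hg hl
    have h2 := ih hf (hg.cons hv) hl
    rw [show wordDegree l + (m + v.1 + n) = wordDegree (v :: l) + (m + n) by simp; ring] at h1
    rw [show wordDegree l + (m + (n + v.1)) = wordDegree (v :: l) + (m + n) by simp; ring] at h2
    exact Submodule.add_mem _ (Submodule.smul_mem _ _ h1) h2

theorem HasWordDegree.add {𝒲 : ℤ → Submodule 𝕜 W} {ℳ : ℤ → Submodule 𝕜 M} {n : ℤ}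
    {f g : List (ℤ × W) → M} (hf : HasWordDegree 𝒲 ℳ n f) (hg : HasWordDegree 𝒲 ℳ n g) :
    HasWordDegree 𝒲 ℳ n (f + g) := fun l hl => Submodule.add_mem _ (hf l hl) (hg l hl)

theorem HasWordDegree.smul {𝒲 : ℤ → Submodule 𝕜 W} {ℳ : ℤ → Submodule 𝕜 M} {n : ℤ}
    {f : List (ℤ × W) → M} (hf : HasWordDegree 𝒲 ℳ n f) (c : 𝕜) :
    HasWordDegree 𝒲 ℳ n (c • f) := fun l hl => Submodule.smul_mem _ c (hf l hl)

theorem HasWordDegree.lbracket {𝒲 : ℤ → Submodule 𝕜 W} {m n : ℤ}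
    {f g : List (ℤ × W) → W} (hf : HasWordDegree 𝒲 𝒲 m f)
    (hg : HasWordDegree 𝒲 𝒲 n g) : HasWordDegree 𝒲 𝒲 (m + n) (lbracket 𝕜 m n f g) :=
  fun l hl => Submodule.sub_mem _ (hf.lcirc hg l hl)
    (Submodule.smul_mem _ _ (add_comm n m ▸ hg.lcirc hf l hl))

theorem lbracket_congr_hom {𝒲 : ℤ → Submodule 𝕜 W} {m n : ℤ} {f f' g g' : List (ℤ × W) → W}
    (hf : ∀ l, IsHomWord 𝒲 l → f l = f' l) (hg : ∀ l, IsHomWord 𝒲 l → g l = g' l)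
    (hfm : HasWordDegree 𝒲 𝒲 m f) (hgn : HasWordDegree 𝒲 𝒲 n g)
    {l : List (ℤ × W)} (hl : IsHomWord 𝒲 l) :
    lbracket 𝕜 m n f g l = lbracket 𝕜 m n f' g' l := by
  simp only [lbracket, Pi.sub_apply, Pi.smul_apply]
  rw [lcirc_congr_hom hf (fun l _ h => ⟨hg l h, hgn l h⟩) hl,
    lcirc_congr_hom hg (fun l _ h => ⟨hf l h, hfm l h⟩) hl]

/-- Either `g` is closed before the last letter `z`, which then remains the last argument of `f`, or
`z` closes `g`. In the second case the value of `g` is the last argument of `f`, and the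
endomorphisms attached to the two subwords are composed. -/
theorem lcirc_concat {f : List (ℤ × W) → W} {g : List (ℤ × W) → W}
    {F G : List (ℤ × W) → Module.End 𝕜 W} (hf : ∀ l z, f (l ++ [z]) = F l z.2)
    (hg : ∀ l z, g (l ++ [z]) = G l z.2) (n : ℤ) (l : List (ℤ × W)) (z : ℤ × W) :
    lcirc 𝕜 n g f (l ++ [z]) = (lcirc 𝕜 n g F l + lconv 𝕜 n F G l) z.2 := by
  induction l generalizing n f g F G with
  | nil =>
    have h1 := hf [] (z.1 + n, g [z])
    have h2 := hg [] z
    simp only [List.nil_append] at h1 h2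
    simp [lcirc, lconv, h1, ← h2]
  | cons v l ih =>
    have h1 := ih (f := fun w => f (v :: w)) (F := fun w => F (v :: w))
      (fun l z => hf (v :: l) z) hg n
    have h2 := ih (g := fun w => g (v :: w)) (G := fun w => G (v :: w)) hf
      (fun l z => hg (v :: l) z) (n + v.1)
    have h3 := hf ((v.1 + n, g [v]) :: l) z
    simp only [List.cons_append, lcirc, lconv] at h3 ⊢
    rw [h1, h2, h3]
    simp only [LinearMap.add_apply, LinearMap.smul_apply]
    module

/-- Every summand is a value of `f` on a word of total degree `wordDegree l + n`, so the same member
of the family `T` occurs in all of them and linearity suffices. -/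
theorem lcirc_map {M' : Type*} [AddCommGroup M'] [Module 𝕜 M'] {𝒲 : ℤ → Submodule 𝕜 W}
    {m n : ℤ} {g : List (ℤ × W) → W} (hg : HasWordDegree 𝒲 𝒲 n g) (T : ℤ → M →ₗ[𝕜] M')
    {f : List (ℤ × W) → M} {F : List (ℤ × W) → M'}
    (hF : ∀ l, IsHomWord 𝒲 l → F l = T (wordDegree l + m) (f l))
    {l : List (ℤ × W)} (hl : IsHomWord 𝒲 l) :
    lcirc 𝕜 n g F l = T (wordDegree l + (m + n)) (lcirc 𝕜 n g f l) := by
  induction l generalizing m n g f F with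
  | nil => simp [lcirc]
  | cons v l ih =>
    obtain ⟨hv, hl⟩ := isHomWord_cons.1 hl
    rw [lcirc, lcirc, ih (m := m + v.1) (f := fun w => f (v :: w)) hg (fun w hw => ?_) hl,
      ih (hg.cons hv) hF hl, hF _ (isHomWord_cons.2 ⟨hg.singleton hv, hl⟩)]
    · rw [map_add, map_add, map_smul,
        show wordDegree l + (m + v.1 + n) = wordDegree (v :: l) + (m + n) by simp; ring,
        show wordDegree l + (m + (n + v.1)) = wordDegree (v :: l) + (m + n) by simp; ring,
        show wordDegree ((v.1 + n, g [v]) :: l) + m = wordDegree (v :: l) + (m + n) by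
          simp; ring]
    · rw [hF _ (isHomWord_cons.2 ⟨hv, hw⟩), wordDegree_cons]
      congr 2
      ring

/-- Removing the first letter turns the commutator of convolutions into two such commutators, with
the letter absorbed by `f` or by `g`. The induction ends at the empty word, where the claim is the
hypothesis on `T`. -/
theorem lconv_commutator {B : Type*} [Ring B] [Algebra 𝕜 B] {𝒲 : ℤ → Submodule 𝕜 W}
    (T : ℤ → A →ₗ[𝕜] B) (ℳ : ℤ → Submodule 𝕜 A)
    (hT : ∀ i j, ∀ a ∈ ℳ i, ∀ b ∈ ℳ j, T i a * T j b - sign 𝕜 (i * j) • (T j b * T i a) =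
      T (i + j) (a * b - sign 𝕜 (i * j) • (b * a)))
    {m n : ℤ} {f g : List (ℤ × W) → A} {F G : List (ℤ × W) → B}
    (hfm : HasWordDegree 𝒲 ℳ m f) (hgn : HasWordDegree 𝒲 ℳ n g)
    (hF : ∀ l, IsHomWord 𝒲 l → F l = T (wordDegree l + m) (f l))
    (hG : ∀ l, IsHomWord 𝒲 l → G l = T (wordDegree l + n) (g l))
    {l : List (ℤ × W)} (hl : IsHomWord 𝒲 l) :
    lconv 𝕜 n F G l - sign 𝕜 (m * n) • lconv 𝕜 m G F l =
      T (wordDegree l + (m + n)) (lconv 𝕜 n f g l - sign 𝕜 (m * n) • lconv 𝕜 m g f l) := by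
  induction l generalizing m n f g F G with
  | nil =>
    simp only [lconv]
    rw [hF [] hl, hG [] hl]
    have h1 := hfm [] hl
    have h2 := hgn [] hl
    simp only [wordDegree_nil, zero_add] at h1 h2 ⊢
    exact hT _ _ _ h1 _ h2
  | cons v l ih =>
    obtain ⟨hv, hl⟩ := isHomWord_cons.1 hl
    have key : ∀ {H : List (ℤ × W) → B} {h : List (ℤ × W) → A} {m : ℤ},
        (∀ l, IsHomWord 𝒲 l → H l = T (wordDegree l + m) (h l)) →
        ∀ l, IsHomWord 𝒲 l → H (v :: l) = T (wordDegree l + (m + v.1)) (h (v :: l)) := by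
      intro H h m hH l hl
      rw [hH _ (isHomWord_cons.2 ⟨hv, hl⟩), wordDegree_cons]
      congr 2
      ring
    have h1 := ih (hfm.cons hv) hgn (key hF) hG hl
    have h2 := ih hfm (hgn.cons hv) hF (key hG) hl
    rw [show wordDegree l + (m + v.1 + n) = wordDegree (v :: l) + (m + n) by simp; ring] at h1
    rw [show wordDegree l + (m + (n + v.1)) = wordDegree (v :: l) + (m + n) by simp; ring] at h2
    have e1 : lconv 𝕜 n F G (v :: l) - sign 𝕜 (m * n) • lconv 𝕜 m G F (v :: l) =
        sign 𝕜 (n * v.1) • (lconv 𝕜 n (fun w => F (v :: w)) G l -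
          sign 𝕜 ((m + v.1) * n) • lconv 𝕜 (m + v.1) G (fun w => F (v :: w)) l) +
        (lconv 𝕜 (n + v.1) F (fun w => G (v :: w)) l -
          sign 𝕜 (m * (n + v.1)) • lconv 𝕜 m (fun w => G (v :: w)) F l) := by
      simp only [lconv, mul_add, add_mul, sign_add, mul_comm v.1]
      rcases sign_eq_one_or 𝕜 (n * v.1) with h1 | h1 <;> simp only [h1] <;> module
    have e2 : lconv 𝕜 n f g (v :: l) - sign 𝕜 (m * n) • lconv 𝕜 m g f (v :: l) =
        sign 𝕜 (n * v.1) • (lconv 𝕜 n (fun w => f (v :: w)) g l -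
          sign 𝕜 ((m + v.1) * n) • lconv 𝕜 (m + v.1) g (fun w => f (v :: w)) l) +
        (lconv 𝕜 (n + v.1) f (fun w => g (v :: w)) l -
          sign 𝕜 (m * (n + v.1)) • lconv 𝕜 m (fun w => g (v :: w)) f l) := by
      simp only [lconv, mul_add, add_mul, sign_add, mul_comm v.1]
      rcases sign_eq_one_or 𝕜 (n * v.1) with h1 | h1 <;> simp only [h1] <;> module
    rw [e1, e2, h1, h2, map_add, map_smul]

theorem lconv_add_left (n : ℤ) (f f' g : List (ℤ × W) → A) (l : List (ℤ × W)) :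
    lconv 𝕜 n (f + f') g l = lconv 𝕜 n f g l + lconv 𝕜 n f' g l := by
  induction l generalizing n f f' g with
  | nil => simp [lconv, add_mul]
  | cons v l ih =>
    simp only [lconv, ih, Pi.add_apply]
    rw [show (fun w => f (v :: w) + f' (v :: w)) =
      (fun w => f (v :: w)) + fun w => f' (v :: w) from rfl, ih]
    module

theorem lconv_add_right (n : ℤ) (f g g' : List (ℤ × W) → A) (l : List (ℤ × W)) :
    lconv 𝕜 n f (g + g') l = lconv 𝕜 n f g l + lconv 𝕜 n f g' l := by
  induction l generalizing n f g g' with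
  | nil => simp [lconv, mul_add]
  | cons v l ih =>
    simp only [lconv, ih, Pi.add_apply]
    rw [show (fun w => g (v :: w) + g' (v :: w)) =
      (fun w => g (v :: w)) + fun w => g' (v :: w) from rfl, ih]
    module

theorem lconv_smul_left (n : ℤ) (c : 𝕜) (f g : List (ℤ × W) → A) (l : List (ℤ × W)) :
    lconv 𝕜 n (c • f) g l = c • lconv 𝕜 n f g l := by
  induction l generalizing n f g with
  | nil => simp [lconv]
  | cons v l ih =>
    simp only [lconv, ih, Pi.smul_apply]
    rw [show (fun w => c • f (v :: w)) = c • (fun w => f (v :: w)) from rfl, ih]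
    module

theorem lconv_smul_right (n : ℤ) (c : 𝕜) (f g : List (ℤ × W) → A) (l : List (ℤ × W)) :
    lconv 𝕜 n f (c • g) l = c • lconv 𝕜 n f g l := by
  induction l generalizing n f g with
  | nil => simp [lconv]
  | cons v l ih =>
    simp only [lconv, ih, Pi.smul_apply]
    rw [show (fun w => c • g (v :: w)) = c • (fun w => g (v :: w)) from rfl, ih]
    module

theorem WordLinear.lconv {f g : List (ℤ × W) → A} (hf : WordLinear 𝕜 f)
    (hg : WordLinear 𝕜 g) (n : ℤ) : WordLinear 𝕜 (lconv 𝕜 n f g) where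
  add u := by
    induction u generalizing n f g with
    | nil =>
      intro d x y w
      simp only [List.nil_append, Nambu.lconv]
      have h1 : (fun w => f ((d, x + y) :: w)) =
        (fun w => f ((d, x) :: w)) + fun w => f ((d, y) :: w) := funext (hf.add [] d x y)
      have h2 : (fun w => g ((d, x + y) :: w)) =
        (fun w => g ((d, x) :: w)) + fun w => g ((d, y) :: w) := funext (hg.add [] d x y)
      rw [h1, h2, lconv_add_left, lconv_add_right]
      module
    | cons v u ih =>
      intro d x y w
      simp only [List.cons_append, Nambu.lconv, ih (hf.cons v) hg, ih hf (hg.cons v)]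
      module
  smul u := by
    induction u generalizing n f g with
    | nil =>
      intro d c x w
      simp only [List.nil_append, Nambu.lconv]
      have h1 : (fun w => f ((d, c • x) :: w)) =
        c • fun w => f ((d, x) :: w) := funext (hf.smul [] d c x)
      have h2 : (fun w => g ((d, c • x) :: w)) =
        c • fun w => g ((d, x) :: w) := funext (hg.smul [] d c x)
      rw [h1, h2, lconv_smul_left, lconv_smul_right]
      module
    | cons v u ih =>
      intro d c x w
      simp only [List.cons_append, Nambu.lconv, ih (hf.cons v) hg, ih hf (hg.cons v)]
      module

end Words

/-! ### Recursion for shuffles -/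

section Shuffles

/-- The permutation of `Fin (N + 1)` that sends `p` to `0` and is `σ` on the other places. -/
def insertPerm {N : ℕ} (p : Fin (N + 1)) (σ : Equiv.Perm (Fin N)) : Equiv.Perm (Fin (N + 1)) :=
  ((finSuccEquiv' p).trans σ.optionCongr).trans (finSuccEquiv' 0).symm

@[simp] theorem insertPerm_self {N : ℕ} (p : Fin (N + 1)) (σ : Equiv.Perm (Fin N)) :
    insertPerm p σ p = 0 := by simp [insertPerm]

@[simp] theorem insertPerm_succAbove {N : ℕ} (p : Fin (N + 1)) (σ : Equiv.Perm (Fin N))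
    (i : Fin N) : insertPerm p σ (p.succAbove i) = (σ i).succ := by simp [insertPerm]

/-- The place `p` is recovered as the preimage of `0`, which gives injectivity; surjectivity follows
from `(N + 1) * N! = (N + 1)!`. -/
theorem insertPerm_bijective (N : ℕ) : Function.Bijective
    fun x : Fin (N + 1) × Equiv.Perm (Fin N) => insertPerm x.1 x.2 := by
  rw [Fintype.bijective_iff_injective_and_card]
  constructor
  · rintro ⟨p, σ⟩ ⟨q, τ⟩ h
    simp only at h
    have hp : p = q := by
      apply (insertPerm q τ).injective
      rw [insertPerm_self, ← h, insertPerm_self]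
    subst hp
    refine Prod.ext rfl (Equiv.ext fun i => ?_)
    have := congrArg (fun e => e (p.succAbove i)) h
    simpa using this
  · simp [Fintype.card_perm, Nat.factorial_succ]

theorem mem_shuffles {N k b : ℕ} {σ : Equiv.Perm (Fin N)} : σ ∈ shuffles N k b ↔
    (∀ i j : Fin N, i < j → (j : ℕ) < k → σ i < σ j) ∧
    (∀ i j : Fin N, k ≤ (i : ℕ) → i < j → (j : ℕ) < k + b → σ i < σ j) ∧
    (∀ i : Fin N, k + b ≤ (i : ℕ) → σ i = i) := by
  simp [shuffles]

theorem insertPerm_zero_mem_shuffles {N k b : ℕ} {σ : Equiv.Perm (Fin N)} :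
    insertPerm 0 σ ∈ shuffles (N + 1) (k + 1) b ↔ σ ∈ shuffles N k b := by
  have hs : ∀ i, insertPerm 0 σ (Fin.succ i) = (σ i).succ := fun i => by
    rw [← Fin.succAbove_zero_apply, insertPerm_succAbove]
  simp only [mem_shuffles, Fin.forall_fin_succ, hs, insertPerm_self, Fin.succ_lt_succ_iff,
    Fin.val_succ, Fin.succ_inj, Fin.val_zero]
  constructor
  · rintro ⟨h1, h2, h3⟩
    exact ⟨fun i j hij hj => (h1.2 i).2 j hij (by omega),
      fun i j hi hij hj => (h2.2 i).2 j (by omega) hij (by omega),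
      fun i hi => h3.2 i (by omega)⟩
  · rintro ⟨h1, h2, h3⟩
    refine ⟨⟨⟨by simp, fun j _ _ => Fin.succ_pos _⟩, fun i => ⟨by simp, fun j hij hj =>
      h1 i j hij (by omega)⟩⟩, ⟨⟨by simp, fun j h => by omega⟩, fun i => ⟨by simp, fun j hi hij hj =>
      h2 i j (by omega) hij (by omega)⟩⟩, by simp, fun i hi => h3 i (by omega)⟩

theorem insertPerm_mem_shuffles {N k b : ℕ} (hk : k < N + 1)
    {σ : Equiv.Perm (Fin N)} :
    insertPerm ⟨k, hk⟩ σ ∈ shuffles (N + 1) k (b + 1) ↔ σ ∈ shuffles N k b := by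
  set p : Fin (N + 1) := ⟨k, hk⟩ with hp
  have hv : ∀ i : Fin N, ((p.succAbove i : Fin (N + 1)) : ℕ) = if (i : ℕ) < k then (i : ℕ)
      else i + 1 := fun i => by
    simp only [Fin.succAbove, hp, Fin.lt_def, Fin.val_castSucc]
    split_ifs <;> simp
  have hlt : ∀ i j : Fin N, p.succAbove i < p.succAbove j ↔ i < j := fun i j =>
    Fin.succAbove_lt_succAbove_iff
  simp only [mem_shuffles, Fin.forall_iff_succAbove p, insertPerm_self, insertPerm_succAbove,
    Fin.succ_lt_succ_iff, hlt]
  have hpv : (p : ℕ) = k := rfl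
  constructor
  · rintro ⟨h1, h2, h3⟩
    refine ⟨fun i j hij hj => (h1.2 i).2 j hij (by rw [hv, if_pos hj]; exact hj),
      fun i j hi hij hj => (h2.2 i).2 j (by rw [hv]; split_ifs <;> omega) hij
        (by rw [hv]; split_ifs <;> omega), fun i hi => ?_⟩
    have := h3.2 i (by rw [hv]; split_ifs <;> omega)
    have h' := congrArg Fin.val this
    rw [hv, if_neg (by omega), Fin.val_succ] at h'
    ext; omega
  · rintro ⟨h1, h2, h3⟩
    refine ⟨⟨⟨by simp, fun j h1 h2 => ?_⟩, fun i => ⟨fun _ h => by omega, fun j hij hj =>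
      h1 i j hij ?_⟩⟩, ⟨⟨by simp, fun j _ _ _ => Fin.succ_pos _⟩, fun i => ⟨fun hi hip _ => ?_,
      fun j hi hij hj => h2 i j ?_ hij ?_⟩⟩, fun h => by omega, fun i hi => ?_⟩
    · have := Fin.lt_def.1 h1; omega
    · rw [hv] at hj; split_ifs at hj <;> omega
    · have := Fin.lt_def.1 hip; omega
    · rw [hv] at hi; split_ifs at hi <;> omega
    · rw [hv] at hj; split_ifs at hj <;> omega
    · rw [hv] at hi
      have h0 : ¬ (i : ℕ) < k := fun h => by rw [if_pos h] at hi; omega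
      rw [if_neg h0] at hi
      ext
      rw [hv, if_neg h0, h3 i (by omega), Fin.val_succ]

/-- Since a shuffle increases on both blocks, its smallest value stands at the beginning of one of
them. If both blocks are empty, place `0` is fixed. -/
theorem eq_of_insertPerm_mem_shuffles {N k b : ℕ} {p : Fin (N + 1)} {σ : Equiv.Perm (Fin N)}
    (h : insertPerm p σ ∈ shuffles (N + 1) k b) :
    ((p : ℕ) = 0 ∧ (0 < k ∨ k + b = 0)) ∨ ((p : ℕ) = k ∧ 0 < b) := by
  rw [mem_shuffles] at h
  obtain ⟨h1, h2, h3⟩ := h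
  by_contra! hc
  rcases lt_trichotomy (p : ℕ) k with hp | hp | hp
  · have := h1 0 p (by rw [Fin.lt_def, Fin.val_zero]; omega) hp
    simp at this
  · have := h3 p (by omega)
    rw [insertPerm_self] at this
    have := congrArg Fin.val this
    simp at this
    omega
  · by_cases hb : (p : ℕ) < k + b
    · have := h2 ⟨k, by omega⟩ p le_rfl hp hb
      simp at this
    · have := h3 p (by omega)
      rw [insertPerm_self] at this
      have := congrArg Fin.val this
      simp at this
      omega

open Classical in
theorem sum_shuffles_eq {M : Type*} [AddCommMonoid M] {N k b : ℕ}
    (F : Equiv.Perm (Fin (N + 1)) → M) :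
    ∑ σ ∈ shuffles (N + 1) k b, F σ =
      ∑ p : Fin (N + 1), ∑ σ : Equiv.Perm (Fin N),
        if insertPerm p σ ∈ shuffles (N + 1) k b then F (insertPerm p σ) else 0 := by
  rw [← Fintype.sum_prod_type', (insertPerm_bijective N).sum_comp
    (fun σ => if σ ∈ shuffles (N + 1) k b then F σ else 0), Finset.sum_ite_mem, Finset.univ_inter]

theorem shuffles_zero_zero (N : ℕ) : shuffles N 0 0 = {1} := by
  ext σ
  simp only [mem_shuffles, Finset.mem_singleton]
  constructor
  · rintro ⟨-, -, h⟩
    exact Equiv.ext fun i => h i (by simp)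
  · rintro rfl
    simp

theorem sum_shuffles_succ_zero {M : Type*} [AddCommMonoid M] {N k : ℕ}
    (F : Equiv.Perm (Fin (N + 1)) → M) :
    ∑ σ ∈ shuffles (N + 1) (k + 1) 0, F σ = ∑ σ ∈ shuffles N k 0, F (insertPerm 0 σ) := by
  classical
  rw [sum_shuffles_eq, Finset.sum_eq_single 0]
  · simp only [insertPerm_zero_mem_shuffles]
    rw [Finset.sum_ite_mem, Finset.univ_inter]
  · intro p _ hp
    refine Finset.sum_eq_zero fun σ _ => if_neg fun h => hp ?_
    rcases eq_of_insertPerm_mem_shuffles h with h | h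
    · exact Fin.ext h.1
    · omega
  · simp

theorem sum_shuffles_zero_succ {M : Type*} [AddCommMonoid M] {N b : ℕ}
    (F : Equiv.Perm (Fin (N + 1)) → M) :
    ∑ σ ∈ shuffles (N + 1) 0 (b + 1), F σ = ∑ σ ∈ shuffles N 0 b, F (insertPerm 0 σ) := by
  classical
  rw [sum_shuffles_eq, Finset.sum_eq_single 0]
  · have := fun σ => insertPerm_mem_shuffles (b := b) (σ := σ) (Nat.succ_pos N)
    simp only [Fin.zero_eta] at this
    simp only [this]
    rw [Finset.sum_ite_mem, Finset.univ_inter]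
  · intro p _ hp
    refine Finset.sum_eq_zero fun σ _ => if_neg fun h => hp ?_
    rcases eq_of_insertPerm_mem_shuffles h with h | h
    · exact Fin.ext h.1
    · exact Fin.ext h.1
  · simp

/-- This is Pascal's recursion: the value `0` is removed from the head of the first or of the second
block. -/
theorem sum_shuffles_succ_succ {M : Type*} [AddCommMonoid M] {N k b : ℕ} (hk : k + 1 < N + 1)
    (F : Equiv.Perm (Fin (N + 1)) → M) :
    ∑ σ ∈ shuffles (N + 1) (k + 1) (b + 1), F σ =
      ∑ σ ∈ shuffles N k (b + 1), F (insertPerm 0 σ) +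
        ∑ σ ∈ shuffles N (k + 1) b, F (insertPerm ⟨k + 1, hk⟩ σ) := by
  classical
  rw [sum_shuffles_eq, Finset.sum_eq_add 0 ⟨k + 1, hk⟩]
  · simp only [insertPerm_zero_mem_shuffles, insertPerm_mem_shuffles]
    rw [Finset.sum_ite_mem, Finset.univ_inter, Finset.sum_ite_mem, Finset.univ_inter]
  · intro h
    simpa using congrArg Fin.val h
  · intro p _ hp
    refine Finset.sum_eq_zero fun σ _ => if_neg fun h => ?_
    rcases eq_of_insertPerm_mem_shuffles h with h | h
    · exact hp.1 (Fin.ext h.1)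
    · exact hp.2 (Fin.ext h.1)
  · simp
  · simp

end Shuffles

/-! ### The recursive products as signed sums over shuffles -/

section ShuffleSums

variable {𝕜 : Type*} [Field 𝕜]

theorem leadingDegree_insertPerm_zero {N : ℕ} (d : Fin (N + 1) → ℤ) (σ : Equiv.Perm (Fin N))
    (k : ℕ) : leadingDegree d (insertPerm 0 σ) (k + 1) =
      d 0 + leadingDegree (fun i => d i.succ) σ k := by
  rw [leadingDegree, Fin.sum_univ_succAbove _ 0]
  have := fun i => insertPerm_succAbove 0 σ i
  simp only [Fin.succAbove_zero] at this
  simp [leadingDegree, this]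

theorem leadingDegree_insertPerm {N k : ℕ} (d : Fin (N + 1) → ℤ) (σ : Equiv.Perm (Fin N))
    (hk : k < N + 1) : leadingDegree d (insertPerm ⟨k, hk⟩ σ) k =
      leadingDegree (fun i => d i.succ) σ k := by
  rw [leadingDegree, Fin.sum_univ_succAbove _ ⟨k, hk⟩]
  simp only [lt_irrefl, if_false, zero_add, leadingDegree, insertPerm_succAbove]
  refine Finset.sum_congr rfl fun i _ => ?_
  have : ((Fin.succAbove ⟨k, hk⟩ i : Fin (N + 1)) : ℕ) < k ↔ (i : ℕ) < k := by
    simp only [Fin.succAbove, Fin.lt_def, Fin.val_castSucc]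
    split_ifs with h
    · simp [h]
    · simp; omega
  simp only [this]

/-- The vector of index `0` is interchanged exactly with those placed before `p`; the other
inversions are the ones of `σ`. -/
theorem koszulSign_insertPerm {N : ℕ} (d : Fin (N + 1) → ℤ) (p : Fin (N + 1))
    (σ : Equiv.Perm (Fin N)) : koszulSign 𝕜 d (insertPerm p σ) =
      sign 𝕜 (d 0 * leadingDegree (fun i => d i.succ) σ p) *
        koszulSign 𝕜 (fun i => d i.succ) σ := by
  rw [koszulSign, koszulSign, ← sign_add]
  congr 1
  rw [Fin.sum_univ_succAbove _ p]
  have h0 : ∀ j : Fin (N + 1), ¬ (insertPerm p σ j < insertPerm p σ p) := by simp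
  simp only [h0, and_false, if_false, Finset.sum_const_zero, zero_add]
  have h1 : ∀ i : Fin N, (p.succAbove i < p) ↔ (i : ℕ) < p := fun i => by
    rw [Fin.succAbove_lt_iff_castSucc_lt, Fin.lt_def, Fin.val_castSucc]
  simp only [Fin.sum_univ_succAbove _ p, insertPerm_self, insertPerm_succAbove,
    Fin.succAbove_lt_succAbove_iff, Fin.succ_lt_succ_iff, Finset.sum_add_distrib, h1,
    Fin.succ_pos, and_true]
  congr 1
  rw [leadingDegree, Finset.mul_sum]
  refine Finset.sum_congr rfl fun i _ => ?_
  split_ifs <;> ring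

theorem ofFn_insertPerm_zero {α : Type*} {N : ℕ} (u : Fin (N + 1) → α) (σ : Equiv.Perm (Fin N)) :
    List.ofFn (fun i => u (insertPerm 0 σ i)) = u 0 :: List.ofFn fun i => u (σ i).succ := by
  rw [List.ofFn_succ]
  have := fun i => insertPerm_succAbove 0 σ i
  simp only [Fin.succAbove_zero] at this
  simp [this]

theorem ofFn_insertPerm {α : Type*} {N k : ℕ} (u : Fin (N + 1) → α) (σ : Equiv.Perm (Fin N))
    (hk : k < N + 1) :
    List.ofFn (fun i => u (insertPerm ⟨k, hk⟩ σ i)) =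
      (List.ofFn fun i => u (σ i).succ).take k ++ u 0 ::
        (List.ofFn fun i => u (σ i).succ).drop k := by
  apply List.ext_getElem
  · simp; omega
  · intro i h1 h2
    simp only [List.length_ofFn] at h1
    rw [List.getElem_ofFn]
    obtain h | ⟨j, h⟩ := Fin.eq_self_or_eq_succAbove ⟨k, hk⟩ ⟨i, h1⟩
    · rw [h, insertPerm_self]
      have : i = k := congrArg Fin.val h
      subst this
      rw [List.getElem_append_right (by simp)]
      simp [min_eq_left (Nat.lt_succ_iff.1 hk)]
    · rw [h, insertPerm_succAbove]
      have h' := congrArg Fin.val h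
      simp only [Fin.succAbove, Fin.lt_def, Fin.val_castSucc] at h'
      split_ifs at h' with hj
      · simp only [Fin.val_castSucc] at h'
        subst h'
        rw [List.getElem_append_left (by simpa using hj)]
        simp
      · simp only [Fin.val_succ] at h'
        subst h'
        rw [List.getElem_append_right (by simp; omega)]
        simp only [List.length_take, List.length_ofFn, min_eq_left (Nat.lt_succ_iff.1 hk)]
        rw [List.getElem_cons, dif_neg (by omega)]
        simp only [List.getElem_drop, List.getElem_ofFn]
        congr 3
        ext
        simp; omega

theorem sum_sum_range_succ {M : Type*} [AddCommMonoid M] (N : ℕ) (c : M) (Q A B : ℕ → ℕ → M)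
    (h00 : Q 0 0 = c) (h10 : ∀ k, k < N → Q (k + 1) 0 = A k 0)
    (h01 : ∀ b, b < N → Q 0 (b + 1) = B 0 b)
    (h11 : ∀ k b, k + b + 1 < N → Q (k + 1) (b + 1) = A k (b + 1) + B (k + 1) b) :
    ∑ k ∈ Finset.range (N + 1), ∑ b ∈ Finset.range (N + 1 - k), Q k b =
      ∑ k ∈ Finset.range N, ∑ b ∈ Finset.range (N - k), A k b +
        ∑ k ∈ Finset.range N, ∑ b ∈ Finset.range (N - k), B k b + c := by
  -- Shifting `A` and `B`, extending them by zero, and placing `c` at the corner merges the four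
  -- boundary cases into the single identity `Q = A' + B' + C'` on the triangle `k + b ≤ N`.
  set A' : ℕ → ℕ → M := fun k b => match k with | 0 => 0 | k + 1 => A k b with hA'
  set B' : ℕ → ℕ → M := fun k b => match b with | 0 => 0 | b + 1 => B k b with hB'
  set C' : ℕ → ℕ → M := fun k b => if k + b = 0 then c else 0 with hC'
  have hQ : ∀ k ∈ Finset.range (N + 1), ∀ b ∈ Finset.range (N + 1 - k),
      Q k b = A' k b + B' k b + C' k b := by
    intro k hk b hb
    rw [Finset.mem_range] at hk hb
    rcases k with _ | k <;> rcases b with _ | b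
    · simp [hA', hB', hC', h00]
    · simp [hA', hB', hC', h01 b (by omega)]
    · simp [hA', hB', hC', h10 k (by omega)]
    · simp [hA', hB', hC', h11 k b (by omega)]
  rw [Finset.sum_congr rfl fun k hk => Finset.sum_congr rfl (hQ k hk)]
  simp only [Finset.sum_add_distrib]
  congr 1
  · congr 1
    · rw [Finset.sum_range_succ']
      simp [hA', Nat.add_sub_add_right]
    · rw [Finset.sum_range_succ]
      simp only [Nat.add_sub_cancel_left, Finset.sum_range_one]
      rw [show B' N 0 = 0 from rfl, add_zero]
      refine Finset.sum_congr rfl fun k hk => ?_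
      rw [Finset.mem_range] at hk
      rw [show N + 1 - k = N - k + 1 by omega, Finset.sum_range_succ']
      simp [hB']
  · rw [Finset.sum_eq_single 0]
    · rw [Finset.sum_eq_single 0]
      · simp [hC']
      · intro b _ hb; simp [hC', hb]
      · simp
    · intro k _ hk
      exact Finset.sum_eq_zero fun b _ => by simp [hC', hk]
    · simp

variable {W M A : Type*} [AddCommGroup W] [Module 𝕜 W] [AddCommGroup M] [Module 𝕜 M]
  [Ring A] [Algebra 𝕜 A]

/-- The contribution of a shuffle `σ` to the circle product. -/
def circTerm (n : ℤ) (g : List (ℤ × W) → W) (f : List (ℤ × W) → M) {N : ℕ}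
    (u : Fin N → ℤ × W) (k b : ℕ) (σ : Equiv.Perm (Fin N)) : M :=
  (sign 𝕜 (n * leadingDegree (fun i => (u i).1) σ k) * koszulSign 𝕜 (fun i => (u i).1) σ) •
    f ((List.ofFn fun i => u (σ i)).take k ++
      (wordDegree (((List.ofFn fun i => u (σ i)).drop k).take (b + 1)) + n,
        g (((List.ofFn fun i => u (σ i)).drop k).take (b + 1))) ::
        (List.ofFn fun i => u (σ i)).drop (k + b + 1))

theorem circTerm_insertPerm_zero (n : ℤ) (g : List (ℤ × W) → W) (f : List (ℤ × W) → M) {N : ℕ}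
    (u : Fin (N + 1) → ℤ × W) (k b : ℕ) (σ : Equiv.Perm (Fin N)) :
    circTerm (𝕜 := 𝕜) n g f u (k + 1) b (insertPerm 0 σ) =
      sign 𝕜 (n * (u 0).1) • circTerm (𝕜 := 𝕜) n g (fun w => f (u 0 :: w))
        (fun i => u i.succ) k b σ := by
  simp only [circTerm, leadingDegree_insertPerm_zero, koszulSign_insertPerm, ofFn_insertPerm_zero]
  have h0 : leadingDegree (fun i => (u i.succ).1) σ ((0 : Fin (N + 1)) : ℕ) = 0 := by
    simp [leadingDegree]
  rw [h0, show k + 1 + b + 1 = k + b + 1 + 1 by ring]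
  simp only [List.take_succ_cons, List.drop_succ_cons, List.cons_append, mul_add, sign_add,
    mul_zero, sign_zero, one_mul, smul_smul, mul_assoc]

/-- The Koszul sign for moving `u 0` behind the first `k` letters has the same form as the sign for
moving `g` there. Together they are the sign of the partially applied `g`, of degree `n + (u 0).1`.
-/
theorem circTerm_insertPerm (n : ℤ) (g : List (ℤ × W) → W) (f : List (ℤ × W) → M) {N : ℕ}
    (u : Fin (N + 1) → ℤ × W) (k b : ℕ) (hk : k < N + 1) (σ : Equiv.Perm (Fin N)) :
    circTerm (𝕜 := 𝕜) n g f u k (b + 1) (insertPerm ⟨k, hk⟩ σ) =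
      circTerm (𝕜 := 𝕜) (n + (u 0).1) (fun w => g (u 0 :: w)) f (fun i => u i.succ) k b σ := by
  have hk' : k ≤ N := by omega
  simp only [circTerm, leadingDegree_insertPerm, koszulSign_insertPerm, ofFn_insertPerm]
  set L := List.ofFn fun i => u (σ i).succ with hL
  have hlen : L.length = N := by simp [hL]
  have e1 : (L.take k ++ u 0 :: L.drop k).take k = L.take k := by
    rw [List.take_append_of_le_length (by simp [hlen, hk'])]; simp
  have e2 : (L.take k ++ u 0 :: L.drop k).drop k = u 0 :: L.drop k :=
    List.drop_left' (by simp [hlen, hk'])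
  have e3 : (L.take k ++ u 0 :: L.drop k).drop (k + (b + 1) + 1) = L.drop (k + b + 1) := by
    rw [show k + (b + 1) + 1 = k + (b + 1 + 1) by ring, ← List.drop_drop, e2,
      List.drop_succ_cons, List.drop_drop, add_assoc]
  rw [e1, e2, e3, List.take_succ_cons, wordDegree_cons, add_mul, sign_add, mul_assoc]
  congr 5
  ring

theorem circTerm_zero_zero (n : ℤ) (g : List (ℤ × W) → W) (f : List (ℤ × W) → M) {N : ℕ}
    (u : Fin (N + 1) → ℤ × W) : circTerm (𝕜 := 𝕜) n g f u 0 0 1 =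
      f (((u 0).1 + n, g [u 0]) :: List.ofFn fun i => u i.succ) := by
  rw [circTerm]
  have h : ∀ d : Fin (N + 1) → ℤ, koszulSign 𝕜 d 1 = 1 := fun d => by
    rw [koszulSign, Finset.sum_eq_zero, sign_zero]
    intro i _
    refine Finset.sum_eq_zero fun j _ => if_neg ?_
    rintro ⟨h1, h2⟩
    exact lt_asymm h1 h2
  simp [h, leadingDegree, sign_zero, List.ofFn_succ]

/-- The three terms of the recursion match the shuffles whose smallest index heads the arguments
preceding `g`, those where it heads the arguments of `g`, and the case `k = b = 0`, where `u 0`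
alone is inserted into `g`. -/
theorem lcirc_ofFn (n : ℤ) (g : List (ℤ × W) → W) (f : List (ℤ × W) → M) {N : ℕ}
    (u : Fin N → ℤ × W) : lcirc 𝕜 n g f (List.ofFn u) =
      ∑ k ∈ Finset.range N, ∑ b ∈ Finset.range (N - k), ∑ σ ∈ shuffles N k b,
        circTerm (𝕜 := 𝕜) n g f u k b σ := by
  induction N generalizing n f g with
  | zero => simp [lcirc]
  | succ N ih =>
    rw [sum_sum_range_succ N (f (((u 0).1 + n, g [u 0]) :: List.ofFn fun i => u i.succ)) _
      (fun k b => ∑ σ ∈ shuffles N k b, sign 𝕜 (n * (u 0).1) •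
        circTerm (𝕜 := 𝕜) n g (fun w => f (u 0 :: w)) (fun i => u i.succ) k b σ)
      (fun k b => ∑ σ ∈ shuffles N k b, circTerm (𝕜 := 𝕜) (n + (u 0).1)
        (fun w => g (u 0 :: w)) f (fun i => u i.succ) k b σ)]
    · rw [List.ofFn_succ, lcirc, ih, ih]
      simp only [Finset.smul_sum]
    · rw [shuffles_zero_zero, Finset.sum_singleton, circTerm_zero_zero]
    · intro k _
      simp only [sum_shuffles_succ_zero, circTerm_insertPerm_zero]
    · intro b _
      rw [sum_shuffles_zero_succ]
      exact Finset.sum_congr rfl fun σ _ => circTerm_insertPerm n g f u 0 b (Nat.succ_pos N) σ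
    · intro k b h
      rw [sum_shuffles_succ_succ (by omega)]
      simp only [circTerm_insertPerm_zero, circTerm_insertPerm]

/-- The contribution of a shuffle `σ` to the convolution product. -/
def convTerm (n : ℤ) (f g : List (ℤ × W) → A) {N : ℕ}
    (u : Fin N → ℤ × W) (k : ℕ) (σ : Equiv.Perm (Fin N)) : A :=
  (sign 𝕜 (n * leadingDegree (fun i => (u i).1) σ k) * koszulSign 𝕜 (fun i => (u i).1) σ) •
    (f ((List.ofFn fun i => u (σ i)).take k) * g ((List.ofFn fun i => u (σ i)).drop k))

theorem convTerm_insertPerm_zero (n : ℤ) (f g : List (ℤ × W) → A) {N : ℕ}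
    (u : Fin (N + 1) → ℤ × W) (k : ℕ) (σ : Equiv.Perm (Fin N)) :
    convTerm (𝕜 := 𝕜) n f g u (k + 1) (insertPerm 0 σ) =
      sign 𝕜 (n * (u 0).1) • convTerm (𝕜 := 𝕜) n (fun w => f (u 0 :: w)) g
        (fun i => u i.succ) k σ := by
  simp only [convTerm, leadingDegree_insertPerm_zero, koszulSign_insertPerm, ofFn_insertPerm_zero]
  have h0 : leadingDegree (fun i => (u i.succ).1) σ ((0 : Fin (N + 1)) : ℕ) = 0 := by
    simp [leadingDegree]
  rw [h0]
  simp only [List.take_succ_cons, List.drop_succ_cons, mul_add, sign_add,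
    mul_zero, sign_zero, one_mul, smul_smul, mul_assoc]

theorem convTerm_insertPerm (n : ℤ) (f g : List (ℤ × W) → A) {N : ℕ}
    (u : Fin (N + 1) → ℤ × W) (k : ℕ) (hk : k < N + 1) (σ : Equiv.Perm (Fin N)) :
    convTerm (𝕜 := 𝕜) n f g u k (insertPerm ⟨k, hk⟩ σ) =
      convTerm (𝕜 := 𝕜) (n + (u 0).1) f (fun w => g (u 0 :: w)) (fun i => u i.succ) k σ := by
  have hk' : k ≤ N := by omega
  simp only [convTerm, leadingDegree_insertPerm, koszulSign_insertPerm, ofFn_insertPerm]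
  set L := List.ofFn fun i => u (σ i).succ with hL
  have hlen : L.length = N := by simp [hL]
  have e1 : (L.take k ++ u 0 :: L.drop k).take k = L.take k := by
    rw [List.take_append_of_le_length (by simp [hlen, hk'])]; simp
  have e2 : (L.take k ++ u 0 :: L.drop k).drop k = u 0 :: L.drop k :=
    List.drop_left' (by simp [hlen, hk'])
  rw [e1, e2, add_mul, sign_add, mul_assoc]

theorem lconv_ofFn (n : ℤ) (f g : List (ℤ × W) → A) {N : ℕ} (u : Fin N → ℤ × W) :
    lconv 𝕜 n f g (List.ofFn u) = ∑ p ∈ Finset.HasAntidiagonal.antidiagonal N, ∑ σ ∈ shuffles N p.1 p.2,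
      convTerm (𝕜 := 𝕜) n f g u p.1 σ := by
  induction N generalizing n f g with
  | zero =>
    simp [lconv, shuffles_zero_zero, convTerm, leadingDegree, koszulSign, sign_zero]
  | succ N ih =>
    set Q : ℕ → ℕ → A := fun k b => ∑ σ ∈ shuffles (N + 1) k b, convTerm (𝕜 := 𝕜) n f g u k σ
      with hQ
    set P : ℕ → ℕ → A := fun k b => ∑ σ ∈ shuffles N k b, sign 𝕜 (n * (u 0).1) •
        convTerm (𝕜 := 𝕜) n (fun w => f (u 0 :: w)) g (fun i => u i.succ) k σ with hP
    set R : ℕ → ℕ → A := fun k b => ∑ σ ∈ shuffles N k b, convTerm (𝕜 := 𝕜) (n + (u 0).1)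
        f (fun w => g (u 0 :: w)) (fun i => u i.succ) k σ with hR
    -- Extension by zero makes one recursion valid on the whole antidiagonal, including the pairs
    -- with an empty block.
    set P' : ℕ × ℕ → A := fun p => match p with | (0, _) => 0 | (k + 1, b) => P k b with hP'
    set R' : ℕ × ℕ → A := fun p => match p with | (_, 0) => 0 | (k, b + 1) => R k b with hR'
    have key : ∀ p ∈ Finset.HasAntidiagonal.antidiagonal (N + 1), Q p.1 p.2 = P' p + R' p := by
      rintro ⟨k, b⟩ hp
      rw [Finset.HasAntidiagonal.mem_antidiagonal] at hp
      simp only at hp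
      rcases k with _ | k <;> rcases b with _ | b
      · omega
      · simp only [hQ, hP', hR', hR, zero_add]
        rw [sum_shuffles_zero_succ]
        exact Finset.sum_congr rfl fun σ _ => convTerm_insertPerm n f g u 0 (Nat.succ_pos N) σ
      · simp only [hQ, hP', hR', hP, add_zero, sum_shuffles_succ_zero, convTerm_insertPerm_zero]
      · simp only [hQ, hP', hR', hP, hR]
        rw [sum_shuffles_succ_succ (by omega)]
        simp only [convTerm_insertPerm_zero, convTerm_insertPerm]
    rw [Finset.sum_congr rfl key, Finset.sum_add_distrib, Finset.Nat.sum_antidiagonal_succ,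
      Finset.Nat.sum_antidiagonal_succ', List.ofFn_succ, lconv, ih, ih]
    simp only [hP', hR', hP, hR, Finset.smul_sum, zero_add]

end ShuffleSums

/-! ### Words and families of multilinear maps -/

section Letters

variable {W : Type*} [AddCommGroup W]

/-- The letters of a word, without their degrees. -/
def letters (l : List (ℤ × W)) (i : ℕ) : W := (l.getD i 0).2

theorem letters_append_cons {k : ℕ} {p : List (ℤ × W)} (hp : p.length = k) (x : ℤ × W)
    (w : List (ℤ × W)) (t : ℕ) : letters (p ++ x :: w) t =
      if t < k then letters p t else if t = k then x.2 else letters w (t - k - 1) := by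
  subst hp
  simp only [letters, List.getD_eq_getElem?_getD]
  split_ifs with h1 h2
  · rw [List.getElem?_append_left h1]
  · subst h2; simp
  · rw [List.getElem?_append_right (by omega), List.getElem?_cons, if_neg (by omega)]

theorem letters_take (l : List (ℤ × W)) {m r : ℕ} (h : r < m) :
    letters (l.take m) r = letters l r := by
  simp [letters, h]

theorem letters_drop (l : List (ℤ × W)) (m r : ℕ) :
    letters (l.drop m) r = letters l (m + r) := by
  simp [letters]

theorem letters_ofFn {N i : ℕ} (u : Fin N → ℤ × W) (h : i < N) :
    letters (List.ofFn u) i = (u ⟨i, h⟩).2 := by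
  simp [letters, h]

theorem letters_update {a : ℕ} (p w : List (ℤ × W)) (d : ℤ) (h : p.length < a) (x : W) :
    (fun i : Fin a => letters (p ++ (d, x) :: w) i) =
      Function.update (fun i : Fin a => letters (p ++ (d, 0) :: w) i) ⟨p.length, h⟩ x := by
  funext i
  simp only [letters_append_cons rfl, Function.update_apply, Fin.ext_iff]
  split_ifs <;> first | rfl | omega

theorem exists_eq_ofFn {α : Type*} (l : List α) : ∃ (N : ℕ) (u : Fin N → α), l = List.ofFn u :=
  ⟨l.length, l.get, (List.ofFn_get l).symm⟩

theorem wordDegree_ofFn {N : ℕ} (u : Fin N → ℤ × W) :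
    wordDegree (List.ofFn u) = ∑ i, (u i).1 := by
  simp [wordDegree, List.map_ofFn, List.sum_ofFn]

variable {𝕜 : Type*} [Field 𝕜] [Module 𝕜 W]

theorem isHomWord_ofFn {𝒲 : ℤ → Submodule 𝕜 W} {N : ℕ} {u : Fin N → ℤ × W} :
    IsHomWord 𝒲 (List.ofFn u) ↔ ∀ i, (u i).2 ∈ 𝒲 (u i).1 := by
  simp [IsHomWord, List.mem_ofFn]

/-- The function of words given by a family of multilinear maps. -/
def familyEval {M : Type*} [AddCommGroup M] [Module 𝕜 M]
    (f : (a : ℕ) → MultilinearMap 𝕜 (fun _ : Fin a => W) M) (l : List (ℤ × W)) : M :=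
  f l.length fun i => letters l i

theorem familyEval_eq {M : Type*} [AddCommGroup M] [Module 𝕜 M]
    (f : (a : ℕ) → MultilinearMap 𝕜 (fun _ : Fin a => W) M) {l : List (ℤ × W)} {a : ℕ}
    (h : l.length = a) : familyEval f l = f a fun i => letters l i := by
  subst h; rfl

theorem wordLinear_familyEval {M : Type*} [AddCommGroup M] [Module 𝕜 M]
    (f : (a : ℕ) → MultilinearMap 𝕜 (fun _ : Fin a => W) M) : WordLinear 𝕜 (familyEval f) where
  add p d x y w := by
    have h : ∀ x, (p ++ (d, x) :: w).length = p.length + w.length + 1 := fun x => by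
      simp; ring
    rw [familyEval_eq f (h _), familyEval_eq f (h x), familyEval_eq f (h y),
      letters_update p w d (by omega) (x + y), letters_update p w d (by omega) x,
      letters_update p w d (by omega) y, MultilinearMap.map_update_add]
  smul p d c x w := by
    have h : ∀ x, (p ++ (d, x) :: w).length = p.length + w.length + 1 := fun x => by
      simp; ring
    rw [familyEval_eq f (h _), familyEval_eq f (h x),
      letters_update p w d (by omega) (c • x), letters_update p w d (by omega) x,
      MultilinearMap.map_update_smul]

theorem familyEval_ofFn {M : Type*} [AddCommGroup M] [Module 𝕜 M]
    (f : (a : ℕ) → MultilinearMap 𝕜 (fun _ : Fin a => W) M) {a : ℕ} (u : Fin a → ℤ × W) :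
    familyEval f (List.ofFn u) = f a fun i => (u i).2 := by
  rw [familyEval_eq f (List.length_ofFn)]
  congr 1
  funext i
  rw [letters_ofFn u i.2]

end Letters

/-! ### Leibniz cochains as functions of words; the graded Lie algebra `CLV` -/

section LeibnizWords

variable {𝕜 : Type u} [Field 𝕜] {W : Type v} [AddCommGroup W] [Module 𝕜 W]

/-- A Leibniz cochain, extended by zero to words of length zero. -/
def extendByZero (f : LeibnizCochain 𝕜 W) : (a : ℕ) → MultilinearMap 𝕜 (fun _ : Fin a => W) W
  | 0 => 0
  | a + 1 => f a

/-- The function of words given by a Leibniz cochain. -/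
def wordEval (f : LeibnizCochain 𝕜 W) : List (ℤ × W) → W := familyEval (extendByZero f)

theorem wordEval_eq (f : LeibnizCochain 𝕜 W) {l : List (ℤ × W)} {a : ℕ} (h : l.length = a + 1) :
    wordEval f l = f a fun i => letters l i := familyEval_eq _ h

theorem wordEval_ofFn (f : LeibnizCochain 𝕜 W) {a : ℕ} (u : Fin (a + 1) → ℤ × W) :
    wordEval f (List.ofFn u) = f a fun i => (u i).2 := familyEval_ofFn _ u

@[simp] theorem wordEval_nil (f : LeibnizCochain 𝕜 W) : wordEval f [] = 0 := rfl

theorem wordLinear_wordEval (f : LeibnizCochain 𝕜 W) : WordLinear 𝕜 (wordEval f) :=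
  wordLinear_familyEval _

theorem wordEval_add (f g : LeibnizCochain 𝕜 W) :
    wordEval (f + g) = wordEval f + wordEval g := by
  funext l
  obtain ⟨N, u, rfl⟩ := exists_eq_ofFn l
  cases N with
  | zero => simp
  | succ N => simp only [Pi.add_apply, wordEval_ofFn, add_apply]

theorem wordEval_smul (c : 𝕜) (f : LeibnizCochain 𝕜 W) :
    wordEval (c • f) = c • wordEval f := by
  funext l
  obtain ⟨N, u, rfl⟩ := exists_eq_ofFn l
  cases N with
  | zero => simp
  | succ N => simp only [Pi.smul_apply, wordEval_ofFn, smul_apply]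

/-- Each argument is the finite sum of its homogeneous components, and multilinearity expands both
sides. -/
theorem multilinearMap_ext_hom {M : Type*} [AddCommGroup M] [Module 𝕜 M]
    (𝒲 : ℤ → Submodule 𝕜 W) [DirectSum.Decomposition 𝒲] {r : ℕ}
    {f g : MultilinearMap 𝕜 (fun _ : Fin r => W) M}
    (h : ∀ (d : Fin r → ℤ) (v : Fin r → W), (∀ i, v i ∈ 𝒲 (d i)) → f v = g v) : f = g := by
  classical
  ext v
  have hv : v = fun i => ∑ j ∈ (DirectSum.decompose 𝒲 (v i)).support,
      ((DirectSum.decompose 𝒲 (v i) j : 𝒲 j) : W) :=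
    funext fun i => (DirectSum.sum_support_decompose 𝒲 (v i)).symm
  rw [hv, MultilinearMap.map_sum_finset, MultilinearMap.map_sum_finset]
  exact Finset.sum_congr rfl fun d _ => h d _ fun i => SetLike.coe_mem _

theorem leibnizCochain_ext (𝒲 : ℤ → Submodule 𝕜 W) [DirectSum.Decomposition 𝒲]
    {f g : LeibnizCochain 𝕜 W}
    (h : ∀ l, IsHomWord 𝒲 l → wordEval f l = wordEval g l) : f = g := by
  funext a
  refine multilinearMap_ext_hom 𝒲 fun d v hv => ?_
  have := h (List.ofFn fun i => (d i, v i)) (isHomWord_ofFn.2 hv)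
  rwa [wordEval_ofFn, wordEval_ofFn] at this

theorem hasWordDegree_wordEval_iff {𝒲 : ℤ → Submodule 𝕜 W} {n : ℤ} {f : LeibnizCochain 𝕜 W} :
    HasWordDegree 𝒲 𝒲 n (wordEval f) ↔ f ∈ CLV 𝒲 n := by
  constructor
  · intro h a d v hv
    have := h (List.ofFn fun i => (d i, v i)) (isHomWord_ofFn.2 hv)
    rwa [wordEval_ofFn, wordDegree_ofFn] at this
  · intro h l hl
    obtain ⟨N, u, rfl⟩ := exists_eq_ofFn l
    cases N with
    | zero => simp
    | succ N =>
      rw [wordEval_ofFn, wordDegree_ofFn]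
      exact h N (fun i => (u i).1) (fun i => (u i).2) (isHomWord_ofFn.1 hl)

/-- The degree `e` attached to the inserted value is arbitrary because `wordEval` ignores the
degrees of its letters. -/
theorem insertFun_eq_wordEval (f g : LeibnizCochain 𝕜 W) {a b : ℕ} (k : Fin (a + 1)) (e : ℤ)
    (u : Fin (a + b + 1) → ℤ × W) :
    insertFun (f a) (g b) k (fun i => (u i).2) =
      wordEval f ((List.ofFn u).take k ++
        (e, wordEval g (((List.ofFn u).drop k).take (b + 1))) ::
          (List.ofFn u).drop (k + b + 1)) := by
  have hk := k.2
  have hp : ((List.ofFn u).take k).length = k := by simp; omega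
  rw [wordEval_eq f (a := a) (by simp; omega), wordEval_eq g (a := b) (by simp; omega), insertFun]
  congr 1
  funext t
  have ht := t.2
  rw [letters_append_cons hp]
  simp only [Fin.ext_iff]
  split_ifs with h1 h2
  · rw [letters_take _ h1, letters_ofFn u (by omega)]
  · congr 1
    funext r
    rw [letters_take _ r.2, letters_drop, letters_ofFn u (by omega)]
  · rw [letters_drop, letters_ofFn u (by omega)]
    congr 2
    ext
    simp; omega

theorem leadingDegree_emod {N : ℕ} {d d' : Fin N → ℤ} (h : ∀ i, d i % 2 = d' i % 2)
    (σ : Equiv.Perm (Fin N)) (k : ℕ) : leadingDegree d σ k % 2 = leadingDegree d' σ k % 2 := by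
  rw [leadingDegree, leadingDegree, Finset.sum_int_mod, Finset.sum_int_mod (f := fun i : Fin N =>
    if (i : ℕ) < k then d' (σ i) else 0)]
  congr 1
  refine Finset.sum_congr rfl fun i _ => ?_
  split_ifs
  exacts [h _, rfl]

theorem koszulSign_congr {N : ℕ} {d d' : Fin N → ℤ} (h : ∀ i, d i % 2 = d' i % 2)
    (σ : Equiv.Perm (Fin N)) : koszulSign 𝕜 d σ = koszulSign 𝕜 d' σ := by
  refine sign_congr ?_
  refine Int.ModEq.sum fun i _ => Int.ModEq.sum fun j _ => ?_
  split_ifs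
  exacts [Int.ModEq.mul (h _) (h _), rfl]

theorem sum_antidiagonal_attach {M : Type*} [AddCommMonoid M] (s : ℕ) (Q : ℕ → ℕ → M) :
    ∑ p ∈ (Finset.HasAntidiagonal.antidiagonal s).attach, Q p.1.1 p.1.2 =
      ∑ p ∈ Finset.HasAntidiagonal.antidiagonal s, Q p.1 p.2 :=
  Finset.sum_attach _ (fun p : ℕ × ℕ => Q p.1 p.2)

/-- Both sums run over `k + b < N`, the first entry of the antidiagonal pair being determined as `N
- b`. -/
theorem sum_antidiagonal_sum_range {M : Type*} [AddCommMonoid M] (N : ℕ) (Q : ℕ → ℕ → M) :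
    ∑ p ∈ Finset.HasAntidiagonal.antidiagonal N, ∑ k ∈ Finset.range p.1, Q k p.2 =
      ∑ k ∈ Finset.range N, ∑ b ∈ Finset.range (N - k), Q k b := by
  rw [Finset.sum_sigma', Finset.sum_sigma']
  refine Finset.sum_bij' (fun x _ => ⟨x.2, x.1.2⟩) (fun y _ => ⟨(N - y.2, y.2), y.1⟩) ?_ ?_ ?_ ?_ ?_
  · rintro ⟨⟨a, b⟩, k⟩ h
    simp at h ⊢; omega
  · rintro ⟨k, b⟩ h
    simp at h ⊢; omega
  · rintro ⟨⟨a, b⟩, k⟩ h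
    simp at h ⊢; omega
  · rintro ⟨k, b⟩ h
    rfl
  · rintro ⟨⟨a, b⟩, k⟩ h
    rfl

variable {𝒲 : ℤ → Submodule 𝕜 W} [DirectSum.Decomposition 𝒲]

theorem circComponent_apply (n : ℤ) (f g : LeibnizCochain 𝕜 W) {a b s : ℕ} (h : a + b = s)
    (u : Fin (s + 1) → ℤ × W) (hu : ∀ i, (u i).2 ∈ 𝒲 (u i).1) :
    ((circComponent 𝒲 n (f a) (g b)).domDomCongr (finCongr (congrArg (· + 1) h)))
      (fun i => (u i).2) = ∑ k ∈ Finset.range (a + 1), ∑ σ ∈ shuffles (s + 1) k b,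
        circTerm (𝕜 := 𝕜) n (wordEval g) (wordEval f) u k b σ := by
  subst h
  rw [MultilinearMap.domDomCongr_apply, circComponent]
  simp only [finCongr_refl, Equiv.refl_apply]
  rw [homogeneousGlue_apply 𝒲 _ _ (fun i => (u i).1) _ hu]
  · rw [Finset.sum_range]
    simp only [sum_apply, smul_apply]
    refine Finset.sum_congr rfl fun k _ => Finset.sum_congr rfl fun σ _ => ?_
    rw [circTerm]
    congr 1
    exact insertFun_eq_wordEval f g k _ fun i => u (σ i)
  · intro d d' h
    refine Finset.sum_congr rfl fun k _ => Finset.sum_congr rfl fun σ _ => ?_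
    rw [koszulSign_congr h,
      sign_congr (𝕜 := 𝕜) (Int.ModEq.mul_left n (leadingDegree_emod h σ k))]

theorem wordEval_circ (n : ℤ) (f g : LeibnizCochain 𝕜 W) {l : List (ℤ × W)}
    (hl : IsHomWord 𝒲 l) :
    wordEval (circ 𝒲 n f g) l = lcirc 𝕜 n (wordEval g) (wordEval f) l := by
  obtain ⟨N, u, rfl⟩ := exists_eq_ofFn l
  cases N with
  | zero => simp [lcirc]
  | succ s =>
    have hu := isHomWord_ofFn.1 hl
    rw [wordEval_ofFn, circ, sum_apply, lcirc_ofFn]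
    rw [Finset.sum_congr rfl fun p _ => circComponent_apply n f g
      (Finset.HasAntidiagonal.mem_antidiagonal.mp p.2) u hu]
    -- The component with index `a` has `a + 1` arguments, so the sum over the antidiagonal of `s`
    -- is compared with that of `s + 1`; the extra pair `(0, s + 1)` carries an empty sum over `k`.
    rw [sum_antidiagonal_attach s fun a b => ∑ k ∈ Finset.range (a + 1),
      ∑ σ ∈ shuffles (s + 1) k b, circTerm (𝕜 := 𝕜) n (wordEval g) (wordEval f) u k b σ,
      ← sum_antidiagonal_sum_range (s + 1) fun k b => ∑ σ ∈ shuffles (s + 1) k b,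
        circTerm (𝕜 := 𝕜) n (wordEval g) (wordEval f) u k b σ,
      Finset.Nat.sum_antidiagonal_succ]
    simp

theorem wordEval_balavoineBracket (m n : ℤ) (f g : LeibnizCochain 𝕜 W) {l : List (ℤ × W)}
    (hl : IsHomWord 𝒲 l) : wordEval (balavoineBracket 𝒲 m n f g) l =
      lbracket 𝕜 m n (wordEval f) (wordEval g) l := by
  rw [balavoineBracket, sub_eq_add_neg, ← neg_smul, wordEval_add, wordEval_smul, lbracket]
  simp only [Pi.add_apply, Pi.smul_apply, Pi.sub_apply, wordEval_circ _ _ _ hl]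
  module

-- Cochains are determined by their values on homogeneous words, where the bracket is `lbracket`;
-- the Jacobi identity is then `lbracket_jacobi`.
variable (𝒲) in
theorem isGradedLieAlgebra_CLV : IsGradedLieAlgebra (CLV 𝒲) (balavoineBracket 𝒲) where
  mem m n f hf g hg := by
    rw [← hasWordDegree_wordEval_iff] at hf hg ⊢
    intro l hl
    rw [wordEval_balavoineBracket _ _ _ _ hl]
    exact hf.lbracket hg l hl
  add_left m n f _ f' _ g _ := leibnizCochain_ext 𝒲 fun l hl => by
    simp only [wordEval_add, wordEval_balavoineBracket _ _ _ _ hl, Pi.add_apply, lbracket,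
      lcirc_add, Pi.sub_apply, Pi.smul_apply, lcirc_add_left (wordLinear_wordEval g)]
    module
  smul_left m n c f _ g _ := leibnizCochain_ext 𝒲 fun l hl => by
    simp only [wordEval_smul, wordEval_balavoineBracket _ _ _ _ hl, lbracket,
      lcirc_smul, Pi.sub_apply, Pi.smul_apply, lcirc_smul_left (wordLinear_wordEval g)]
    module
  add_right m n f _ g _ g' _ := leibnizCochain_ext 𝒲 fun l hl => by
    simp only [wordEval_add, wordEval_balavoineBracket _ _ _ _ hl, Pi.add_apply, lbracket,
      lcirc_add, Pi.sub_apply, Pi.smul_apply, lcirc_add_left (wordLinear_wordEval f)]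
    module
  smul_right m n c f _ g _ := leibnizCochain_ext 𝒲 fun l hl => by
    simp only [wordEval_smul, wordEval_balavoineBracket _ _ _ _ hl, lbracket,
      lcirc_smul, Pi.sub_apply, Pi.smul_apply, lcirc_smul_left (wordLinear_wordEval f)]
    module
  antisymm m n f _ g _ := by
    simp only [balavoineBracket, smul_sub, smul_smul, mul_comm n m, sign_mul_self]
    module
  jacobi m n p f hf g hg h hh := leibnizCochain_ext 𝒲 fun l hl => by
    rw [← hasWordDegree_wordEval_iff] at hf hg hh
    -- The inner bracket equals its word version only on homogeneous words. The degree conditions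
    -- ensure that the outer bracket evaluates it only on such words.
    have key : ∀ (m n p : ℤ) (f g h : LeibnizCochain 𝕜 W), HasWordDegree 𝒲 𝒲 m (wordEval f) →
        HasWordDegree 𝒲 𝒲 n (wordEval g) → HasWordDegree 𝒲 𝒲 p (wordEval h) →
        lbracket 𝕜 m (n + p) (wordEval f) (wordEval (balavoineBracket 𝒲 n p g h)) l =
        lbracket 𝕜 m (n + p) (wordEval f) (lbracket 𝕜 n p (wordEval g) (wordEval h)) l :=
      fun m n p f g h hf hg hh => (lbracket_congr_hom (fun _ _ => rfl)
        (fun l hl => (wordEval_balavoineBracket n p g h hl).symm) hf (hg.lbracket hh) hl).symm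
    have key' : lbracket 𝕜 (m + n) p (wordEval (balavoineBracket 𝒲 m n f g)) (wordEval h) l =
        lbracket 𝕜 (m + n) p (lbracket 𝕜 m n (wordEval f) (wordEval g)) (wordEval h) l :=
      (lbracket_congr_hom (fun l hl => (wordEval_balavoineBracket m n f g hl).symm)
        (fun _ _ => rfl) (hf.lbracket hg) hh hl).symm
    simp only [wordEval_add, wordEval_smul, Pi.add_apply, Pi.smul_apply,
      wordEval_balavoineBracket _ _ _ _ hl]
    rw [key m n p f g h hf hg hh, key n m p g f h hg hf hh, key']
    exact lbracket_jacobi (wordLinear_wordEval f) (wordLinear_wordEval g)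
      (wordLinear_wordEval h) m n p l

end LeibnizWords

/-! ### From functions of words back to multilinear maps -/

section Gluing

variable {𝕜 : Type u} [Field 𝕜] {W M : Type v} [AddCommGroup W] [Module 𝕜 W]
  [AddCommGroup M] [Module 𝕜 M]

theorem ofFn_update {N : ℕ} (d : Fin N → ℤ) (v : Fin N → W) (i : Fin N) (x : W) :
    (List.ofFn fun j => (d j, Function.update v i x j)) =
      (List.ofFn fun j => (d j, v j)).take i ++
        (d i, x) :: (List.ofFn fun j => (d j, v j)).drop (i + 1) := by
  have hi := i.2
  apply List.ext_getElem
  · simp; omega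
  · intro j h1 h2
    simp only [List.length_ofFn] at h1
    rw [List.getElem_ofFn]
    rcases lt_trichotomy j i with h | h | h
    · rw [List.getElem_append_left (by simp; omega)]
      simp [Fin.ext_iff, h.ne]
    · subst h
      rw [List.getElem_append_right (by simp)]
      simp
    · rw [List.getElem_append_right (by simp; omega)]
      simp only [List.length_take, List.length_ofFn, min_eq_left hi.le]
      rw [List.getElem_cons, dif_neg (by omega)]
      simp only [List.getElem_drop, List.getElem_ofFn]
      have : i + 1 + (j - i - 1) = j := by omega
      simp [Fin.ext_iff, h.ne', this]

/-- The multilinear map given by a letter-wise linear function of words, for fixed degrees. -/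
def WordLinear.toMultilinearMap {K : List (ℤ × W) → M} (hK : WordLinear 𝕜 K) {N : ℕ}
    (d : Fin N → ℤ) : MultilinearMap 𝕜 (fun _ : Fin N => W) M where
  toFun v := K (List.ofFn fun i => (d i, v i))
  map_update_add' := fun {inst} v i x y => by
    rw [Subsingleton.elim inst (instDecidableEqFin _)]
    rw [ofFn_update, ofFn_update, ofFn_update, hK.add]
  map_update_smul' := fun {inst} v i c x => by
    rw [Subsingleton.elim inst (instDecidableEqFin _)]
    rw [ofFn_update, ofFn_update, hK.smul]

/-- Words with the same letters and degrees of the same parities. -/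
def SameParity (l l' : List (ℤ × W)) : Prop :=
  List.Forall₂ (fun v v' => v.1 % 2 = v'.1 % 2 ∧ v.2 = v'.2) l l'

/-- A function of words may depend on the degrees attached to the letters, whereas a multilinear map
sees only vectors. Dependence through parities alone is what allows gluing along even and odd parts.
-/
theorem familyEval_glue (𝒲 : ℤ → Submodule 𝕜 W) [DirectSum.Decomposition 𝒲]
    {K : List (ℤ × W) → M} (hK : WordLinear 𝕜 K) (hp : ∀ l l', SameParity l l' → K l = K l')
    {l : List (ℤ × W)} (hl : IsHomWord 𝒲 l) :
    familyEval (fun a => homogeneousGlue 𝒲 fun d : Fin a → ℤ => hK.toMultilinearMap d) l =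
      K l := by
  obtain ⟨N, u, rfl⟩ := exists_eq_ofFn l
  rw [familyEval_ofFn, homogeneousGlue_apply 𝒲 _ _ (fun i => (u i).1) _ (isHomWord_ofFn.1 hl)]
  · rfl
  · intro d d' h
    ext v
    refine hp _ _ ?_
    rw [SameParity, List.forall₂_iff_get]
    simpa using fun i hi => h ⟨i, hi⟩

theorem familyEval_congr (f : (a : ℕ) → MultilinearMap 𝕜 (fun _ : Fin a => W) M)
    {l l' : List (ℤ × W)} (h : SameParity l l') : familyEval f l = familyEval f l' := by
  have hlen := h.length_eq
  rw [familyEval_eq f hlen, familyEval]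
  congr 1
  funext i
  simp only [letters]
  have hi := i.2
  rw [List.getD_eq_getElem _ _ (by omega), List.getD_eq_getElem _ _ hi]
  exact (h.get (by omega) hi).2

end Gluing

/-! ### Extension of endomorphisms of `V` to derivations on `V ⊗ V` -/

section Derivations

variable {𝕜 : Type u} [Field 𝕜] {V : Type v} [AddCommGroup V] [Module 𝕜 V]

/-- The endomorphisms of degree `e`. -/
def homEnd (𝒱 : ℤ → Submodule 𝕜 V) (e : ℤ) : Submodule 𝕜 (Module.End 𝕜 V) where
  carrier := {φ | ∀ c, ∀ x ∈ 𝒱 c, φ x ∈ 𝒱 (c + e)}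
  zero_mem' := fun _ _ _ => Submodule.zero_mem _
  add_mem' := fun hf hg c x hx => Submodule.add_mem _ (hf c x hx) (hg c x hx)
  smul_mem' := fun r _ hf c x hx => Submodule.smul_mem _ r (hf c x hx)

theorem mul_mem_homEnd {𝒱 : ℤ → Submodule 𝕜 V} (i j : ℤ) : ∀ φ ∈ homEnd 𝒱 i,
    ∀ ψ ∈ homEnd 𝒱 j, φ * ψ ∈ homEnd 𝒱 (i + j) := by
  intro φ hφ ψ hψ c x hx
  have := hφ _ _ (hψ c x hx)
  rwa [show c + j + i = c + (i + j) by ring] at this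

variable (𝒱 : ℤ → Submodule 𝕜 V) [DirectSum.Decomposition 𝒱]

/-- The extension of an endomorphism of degree `e` to a graded derivation on `V ⊗ V`. -/
def derExt (e : ℤ) : Module.End 𝕜 V →ₗ[𝕜] Module.End 𝕜 (V ⊗[𝕜] V) :=
  (TensorProduct.mapBilinear (RingHom.id 𝕜) V V V V).flip LinearMap.id +
    ∑ c : Fin 2, sign 𝕜 (((c : ℕ) : ℤ) * e) •
      TensorProduct.mapBilinear (RingHom.id 𝕜) V V V V (parityProj 𝒱 c)

theorem derExt_tmul (e : ℤ) (φ : Module.End 𝕜 V) {c : ℤ} {x : V} (hx : x ∈ 𝒱 c) (y : V) :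
    derExt 𝒱 e φ (x ⊗ₜ[𝕜] y) = φ x ⊗ₜ[𝕜] y + sign 𝕜 (c * e) • x ⊗ₜ[𝕜] φ y := by
  simp only [derExt, LinearMap.add_apply, LinearMap.flip_apply,
      Fin.sum_univ_two, LinearMap.smul_apply, TensorProduct.mapBilinear_apply,
      TensorProduct.map_tmul, parityProj_of_mem 𝒱 _ hx, LinearMap.id_apply]
  congr 1
  rcases Int.even_or_odd c with h | h
  · have h0 : c % 2 = 0 := Int.even_iff.mp h
    simp [h0, sign, h.mul_right]
  · have h1 : c % 2 = 1 := Int.odd_iff.mp h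
    rw [sign_congr (𝕜 := 𝕜) (m := c * e) (n := e)]
    · simp [h1]
    · rw [Int.mul_emod, h1]; simp

theorem tensorEnd_ext {α β : Module.End 𝕜 (V ⊗[𝕜] V)}
    (h : ∀ i j, ∀ x ∈ 𝒱 i, ∀ y ∈ 𝒱 j, α (x ⊗ₜ[𝕜] y) = β (x ⊗ₜ[𝕜] y)) : α = β := by
  refine TensorProduct.ext' fun x y => ?_
  induction x using DirectSum.Decomposition.inductionOn 𝒱 with
  | zero => simp
  | add m m' h h' => rw [TensorProduct.add_tmul, map_add, map_add, h, h']
  | homogeneous m =>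
    induction y using DirectSum.Decomposition.inductionOn 𝒱 with
    | zero => simp
    | add m m' h h' => rw [TensorProduct.tmul_add, map_add, map_add, h, h']
    | homogeneous m' => exact h _ _ _ m.2 _ m'.2

theorem leibnizExt_eq_derExt (q : ℤ) {a : ℕ}
    (φ : MultilinearMap 𝕜 (fun _ : Fin a => V ⊗[𝕜] V) (V →ₗ[𝕜] V)) (d : Fin a → ℤ)
    (X : Fin a → V ⊗[𝕜] V) (hX : ∀ i, X i ∈ tensorGrading 𝒱 (d i)) :
    leibnizExt 𝒱 q φ X = derExt 𝒱 (∑ i, d i + q) (φ X) := by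
  refine tensorEnd_ext 𝒱 fun i j x hx y _ => ?_
  rw [leibnizExt_apply 𝒱 q φ d i X x y hX hx, derExt_tmul 𝒱 _ _ hx]

/-- The mixed terms `φ x ⊗ ψ y` and `ψ x ⊗ φ y` cancel in the graded commutator, leaving those in
which both maps act on the same factor. -/
theorem derExt_commutator (i j : ℤ) : ∀ φ ∈ homEnd 𝒱 i, ∀ ψ ∈ homEnd 𝒱 j,
    derExt 𝒱 i φ * derExt 𝒱 j ψ - sign 𝕜 (i * j) • (derExt 𝒱 j ψ * derExt 𝒱 i φ) =
      derExt 𝒱 (i + j) (φ * ψ - sign 𝕜 (i * j) • (ψ * φ)) := by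
  intro φ hφ ψ hψ
  refine tensorEnd_ext 𝒱 fun c c' x hx y _ => ?_
  simp only [LinearMap.sub_apply, LinearMap.smul_apply, Module.End.mul_apply,
    derExt_tmul 𝒱 _ _ hx, map_add, map_smul, derExt_tmul 𝒱 _ _ (hφ c x hx),
    derExt_tmul 𝒱 _ _ (hψ c x hx), TensorProduct.sub_tmul, TensorProduct.tmul_sub,
    ← TensorProduct.smul_tmul', TensorProduct.tmul_smul, mul_add, add_mul, sign_add, mul_comm j i]
  rcases sign_eq_one_or 𝕜 (i * j) with h1 | h1 <;>
  rcases sign_eq_one_or 𝕜 (c * i) with h2 | h2 <;>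
  rcases sign_eq_one_or 𝕜 (c * j) with h3 | h3 <;>
  simp only [h1, h2, h3] <;> module

theorem derExt_mem {e : ℤ} {φ : Module.End 𝕜 V} (hφ : φ ∈ homEnd 𝒱 e) {j : ℤ} {z : V ⊗[𝕜] V}
    (hz : z ∈ tensorGrading 𝒱 j) : derExt 𝒱 e φ z ∈ tensorGrading 𝒱 (j + e) := by
  induction hz using Submodule.span_induction with
  | mem t h =>
    obtain ⟨i, k, h, x, hx, y, hy, rfl⟩ := h
    rw [derExt_tmul 𝒱 _ _ hx]
    exact Submodule.add_mem _
      (tmul_mem_tensorGrading (by rw [← h]; ring) (hφ _ _ hx) hy)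
      (Submodule.smul_mem _ _ (tmul_mem_tensorGrading (by rw [← h]; ring) hx (hφ _ _ hy)))
  | zero => rw [map_zero]; exact Submodule.zero_mem _
  | add a b _ _ ha hb => rw [map_add]; exact Submodule.add_mem _ ha hb
  | smul c a _ ha => rw [map_smul]; exact Submodule.smul_mem _ _ ha

/-- On `x ⊗ x` the hypothesis reads `φ x ⊗ x ± x ⊗ φ x = 0`. Linear functionals on the first factor
exclude `φ x ≠ 0`, both when `φ x` is a multiple of `x` and when it is not. -/
theorem eq_zero_of_derExt_eq_zero (two_ne_zero : (2 : 𝕜) ≠ 0) {e : ℤ} {φ : Module.End 𝕜 V}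
    (hφ : φ ∈ homEnd 𝒱 e) (h : derExt 𝒱 e φ = 0) : φ = 0 := by
  have key : ∀ c, ∀ x ∈ 𝒱 c, φ x = 0 := by
    intro c x hx
    by_contra hne
    have hx0 : x ≠ 0 := fun h0 => hne (by rw [h0, map_zero])
    have h1 := derExt_tmul 𝒱 e φ hx x
    rw [h, LinearMap.zero_apply] at h1
    have h2 : ∀ ℓ : V →ₗ[𝕜] 𝕜, ℓ (φ x) • x + sign 𝕜 (c * e) • ℓ x • φ x = 0 := fun ℓ => by
      have := congrArg ((TensorProduct.lid 𝕜 V) ∘ (LinearMap.rTensor V ℓ)) h1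
      simpa using this.symm
    by_cases hs : φ x ∈ Submodule.span 𝕜 {x}
    · obtain ⟨r, hr⟩ := Submodule.mem_span_singleton.1 hs
      -- A nonzero `φ x = r • x` lies in the degrees `c` and `c + e`, so `e = 0`. The sign is then
      -- `+1` and the relation becomes `2 r x ⊗ x = 0`: here the characteristic enters.
      have hc : c = c + e := DirectSum.degree_eq_of_mem_mem 𝒱
        (hr ▸ Submodule.smul_mem _ r hx : φ x ∈ 𝒱 c) (hφ c x hx) hne
      have he : e = 0 := by omega
      obtain ⟨ℓ, hℓ, -⟩ := Submodule.exists_le_ker_of_notMem (p := (⊥ : Submodule 𝕜 V))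
        (v := x) (by simpa using hx0)
      have h3 := h2 ℓ
      rw [he, mul_zero, sign_zero, ← hr, map_smul, smul_eq_mul, one_smul, smul_smul, mul_comm,
        ← add_smul, smul_eq_zero, or_iff_left hx0, ← two_mul] at h3
      have hr0 : r = 0 := by simpa [two_ne_zero, hℓ] using h3
      exact hne (by rw [← hr, hr0, zero_smul])
    -- A functional that kills `x` but not `φ x` removes the second summand and leaves `ℓ (φ x) • x
    -- = 0`.
    · obtain ⟨ℓ, hℓ, hker⟩ := Submodule.exists_le_ker_of_notMem hs
      have hℓx : ℓ x = 0 := hker (Submodule.mem_span_singleton_self x)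
      have := h2 ℓ
      rw [hℓx] at this
      simp [hℓ, hx0] at this
  ext x
  induction x using DirectSum.Decomposition.inductionOn 𝒱 with
  | zero => simp
  | add m m' h h' => rw [map_add, map_add, h, h']
  | homogeneous m => exact key _ _ m.2

end Derivations

/-! ### The sign in the definition of `Ψ` -/

section TriangularSign

variable (𝕜 : Type*) [Field 𝕜]

/-- The sign `(-1)^{a (a + 1) / 2}`. -/
def triSign (a : ℕ) : 𝕜 := sign 𝕜 (((a + 1) * a / 2 : ℕ) : ℤ)

theorem triSign_mul_self (a : ℕ) : triSign 𝕜 a * triSign 𝕜 a = 1 := sign_mul_self 𝕜 _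

theorem triSign_ne_zero (a : ℕ) : triSign 𝕜 a ≠ 0 := fun h => by
  have := triSign_mul_self 𝕜 a
  simp [h] at this

/-- Triangular numbers fail to be additive by exactly `a * b`. This produces the sign
`(-1)^{(i-1)(j-1)}` in the explicit circle product. -/
theorem triSign_mul (a b : ℕ) :
    triSign 𝕜 a * triSign 𝕜 b = triSign 𝕜 (a + b) * sign 𝕜 (a * b) := by
  rw [triSign, triSign, triSign, ← sign_add, ← sign_add]
  refine sign_congr ?_
  obtain ⟨x, hx⟩ := (Nat.even_mul_succ_self a).two_dvd
  obtain ⟨y, hy⟩ := (Nat.even_mul_succ_self b).two_dvd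
  have hz : (a + b + 1) * (a + b) = 2 * (x + y + a * b) := by
    linear_combination hx + hy
  rw [mul_comm (a + 1), mul_comm (b + 1), hx, hy, hz]
  simp only [Nat.mul_div_cancel_left _ two_pos]
  push_cast
  omega

end TriangularSign

/-! ### The image of `Ψ` and the transported bracket -/

section NambuWords

variable {𝕜 : Type u} [Field 𝕜] {V : Type v} [AddCommGroup V] [Module 𝕜 V]

/-- The endomorphism-valued function of words given by a Nambu cochain, with the signs that
occur in `Psi`. -/
def nambuEval (f : NambuCochain 𝕜 V) : List (ℤ × (V ⊗[𝕜] V)) → Module.End 𝕜 V :=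
  familyEval fun a => triSign 𝕜 a • f a

theorem nambuEval_eq (f : NambuCochain 𝕜 V) {l : List (ℤ × (V ⊗[𝕜] V))} {a : ℕ}
    (h : l.length = a) : nambuEval f l = triSign 𝕜 a • f a fun i => letters l i :=
  familyEval_eq _ h

theorem nambuEval_ofFn (f : NambuCochain 𝕜 V) {a : ℕ} (u : Fin a → ℤ × (V ⊗[𝕜] V)) :
    nambuEval f (List.ofFn u) = triSign 𝕜 a • f a fun i => (u i).2 := familyEval_ofFn _ u

theorem wordLinear_nambuEval (f : NambuCochain 𝕜 V) : WordLinear 𝕜 (nambuEval f) :=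
  wordLinear_familyEval _

/-- Each of the `a` suspended letters adds one to the degree of the word, which accounts for the
shift `n + a` in `CV`. -/
theorem hasWordDegree_nambuEval_iff {𝒱 : ℤ → Submodule 𝕜 V} {n : ℤ} {f : NambuCochain 𝕜 V} :
    HasWordDegree (suspTensor 𝒱) (homEnd 𝒱) n (nambuEval f) ↔ f ∈ CV 𝒱 n := by
  constructor
  · intro h a d c X x hX hx
    have h1 := h (List.ofFn fun i => (d i + 1, X i)) (isHomWord_ofFn.2 fun i => by
      simpa [suspension] using hX i) c x hx
    rw [nambuEval_ofFn, wordDegree_ofFn, LinearMap.smul_apply] at h1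
    have h2 := Submodule.smul_mem _ (triSign 𝕜 a) h1
    rw [smul_smul, triSign_mul_self, one_smul] at h2
    convert h2 using 2
    simp [Finset.sum_add_distrib]
    ring
  · intro h l hl c x hx
    obtain ⟨N, u, rfl⟩ := exists_eq_ofFn l
    rw [nambuEval_ofFn, wordDegree_ofFn, LinearMap.smul_apply]
    have h1 := h N (fun i => (u i).1 - 1) c (fun i => (u i).2) x
      (fun i => isHomWord_ofFn.1 hl i) hx
    refine Submodule.smul_mem _ _ ?_
    convert h1 using 2
    simp [Finset.sum_sub_distrib]
    ring

variable (𝒱 : ℤ → Submodule 𝕜 V) [DirectSum.Decomposition 𝒱]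

/-- The endomorphism-valued function of words that gives `Psi n f` when applied to a last
letter. -/
def psiEval (n : ℤ) (f : NambuCochain 𝕜 V) :
    List (ℤ × (V ⊗[𝕜] V)) → Module.End 𝕜 (V ⊗[𝕜] V) :=
  familyEval fun a => triSign 𝕜 a • leibnizExt 𝒱 (n + a) (f a)

theorem Psi_apply (n : ℤ) (f : NambuCochain 𝕜 V) (a : ℕ) (v : Fin (a + 1) → V ⊗[𝕜] V) :
    Psi 𝒱 n f a v = triSign 𝕜 a •
      leibnizExt 𝒱 (n + a) (f a) (fun i => v i.castSucc) (v (Fin.last a)) := rfl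

theorem wordEval_Psi_concat (n : ℤ) (f : NambuCochain 𝕜 V) (l : List (ℤ × (V ⊗[𝕜] V)))
    (z : ℤ × (V ⊗[𝕜] V)) : wordEval (Psi 𝒱 n f) (l ++ [z]) = psiEval 𝒱 n f l z.2 := by
  rw [wordEval_eq (a := l.length) _ (by simp), Psi_apply, psiEval, familyEval, smul_apply,
    LinearMap.smul_apply]
  congr 2
  · congr 1
    funext i
    rw [letters_append_cons rfl, if_pos (by simp)]
    rfl
  · rw [letters_append_cons rfl, if_neg (by simp), if_pos (by simp)]

/-- The sign in `leibnizExt` involves only the total degree of the frozen arguments and the map; in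
suspended degrees this is `wordDegree l + n`. -/
theorem psiEval_eq_derExt (n : ℤ) (f : NambuCochain 𝕜 V) (l : List (ℤ × (V ⊗[𝕜] V)))
    (hl : IsHomWord (suspTensor 𝒱) l) :
    psiEval 𝒱 n f l = derExt 𝒱 (wordDegree l + n) (nambuEval f l) := by
  obtain ⟨N, u, rfl⟩ := exists_eq_ofFn l
  rw [psiEval, familyEval_ofFn, nambuEval_ofFn, smul_apply, map_smul,
    leibnizExt_eq_derExt 𝒱 _ _ (fun i => (u i).1 - 1) _ (isHomWord_ofFn.1 hl), wordDegree_ofFn]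
  congr 3
  simp [Finset.sum_sub_distrib]

theorem isHomWord_concat {W : Type*} [AddCommGroup W] [Module 𝕜 W] {𝒲 : ℤ → Submodule 𝕜 W}
    {l : List (ℤ × W)} {z : ℤ × W} :
    IsHomWord 𝒲 (l ++ [z]) ↔ IsHomWord 𝒲 l ∧ z.2 ∈ 𝒲 z.1 := by
  simp [IsHomWord, or_imp, forall_and]

theorem Psi_mem_CLV {n : ℤ} {f : NambuCochain 𝕜 V} (hf : f ∈ CV 𝒱 n) :
    Psi 𝒱 n f ∈ CLV (suspTensor 𝒱) n := by
  rw [← hasWordDegree_nambuEval_iff] at hf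
  rw [← hasWordDegree_wordEval_iff]
  intro l hl
  induction l using List.reverseRecOn with
  | nil => simp
  | append_singleton l z _ =>
    obtain ⟨hl, hz⟩ := isHomWord_concat.1 hl
    rw [wordEval_Psi_concat, psiEval_eq_derExt 𝒱 n f l hl]
    have := derExt_mem 𝒱 (hf l hl) hz
    rwa [show z.1 - 1 + (wordDegree l + n) = wordDegree (l ++ [z]) + n - 1 by
      simp [wordDegree]; ring] at this

/-- By linearity it is enough to treat the kernel. There, for frozen homogeneous arguments, an
endomorphism has vanishing derivation extension. -/
theorem Psi_injOn (two_ne_zero : (2 : 𝕜) ≠ 0) (n : ℤ) : Set.InjOn (Psi 𝒱 n) (CV 𝒱 n) := by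
  intro f hf g hg h
  rw [← sub_eq_zero, ← map_sub] at h
  have hd := hasWordDegree_nambuEval_iff.2 (Submodule.sub_mem _ hf hg)
  rw [← sub_eq_zero]
  generalize f - g = e at h hd
  funext a
  refine multilinearMap_ext_hom (tensorGrading 𝒱) fun d X hX => ?_
  have hl : IsHomWord (suspTensor 𝒱) (List.ofFn fun i => (d i + 1, X i)) :=
    isHomWord_ofFn.2 fun i => by simpa [suspension] using hX i
  have h1 : psiEval 𝒱 n e (List.ofFn fun i => (d i + 1, X i)) = 0 := by
    refine LinearMap.ext fun z => ?_
    have h2 := wordEval_Psi_concat 𝒱 n e (List.ofFn fun i => (d i + 1, X i)) (0, z)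
    rw [h, wordEval_eq (a := a) _ (by simp)] at h2
    exact h2.symm
  rw [psiEval_eq_derExt 𝒱 n e _ hl] at h1
  have h2 := eq_zero_of_derExt_eq_zero 𝒱 two_ne_zero (hd _ hl) h1
  rw [nambuEval_ofFn] at h2
  exact (smul_eq_zero.1 h2).resolve_left (triSign_ne_zero 𝕜 a)

/-- The circle product of Nambu cochains as a function of words. -/
def nambuWordCirc (n : ℤ) (f g : NambuCochain 𝕜 V) :
    List (ℤ × (V ⊗[𝕜] V)) → Module.End 𝕜 V :=
  lcirc 𝕜 n (wordEval (Psi 𝒱 n g)) (nambuEval f) + lconv 𝕜 n (nambuEval f) (nambuEval g)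

theorem wordLinear_nambuWordCirc (n : ℤ) (f g : NambuCochain 𝕜 V) :
    WordLinear 𝕜 (nambuWordCirc 𝒱 n f g) :=
  ((wordLinear_nambuEval f).lcirc (wordLinear_wordEval _) n).add_fun
    ((wordLinear_nambuEval f).lconv (wordLinear_nambuEval g) n)

theorem nambuWordCirc_congr (n : ℤ) (f g : NambuCochain 𝕜 V) {l l' : List (ℤ × (V ⊗[𝕜] V))}
    (h : SameParity l l') : nambuWordCirc 𝒱 n f g l = nambuWordCirc 𝒱 n f g l' := by
  have hd : ∀ l l' : List (ℤ × (V ⊗[𝕜] V)), SameParity l l' →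
      (wordDegree l + n) % 2 = (wordDegree l' + n) % 2 := by
    intro l l' h
    refine Int.ModEq.add_right n ?_
    induction h with
    | nil => rfl
    | cons h _ ih => simpa using Int.ModEq.add h.1 ih
  simp only [nambuWordCirc, Pi.add_apply]
  congr 1
  · exact lcirc_congr (fun _ _ h => h.1) rfl (fun _ _ h => familyEval_congr _ h)
      (fun l l' _ h => ⟨hd l l' h, familyEval_congr _ h⟩) h
  · exact lconv_congr (fun _ _ h => h.1) rfl (fun _ _ h => familyEval_congr _ h)
      (fun _ _ h => familyEval_congr _ h) h

theorem hasWordDegree_nambuWordCirc {m n : ℤ} {f g : NambuCochain 𝕜 V} (hf : f ∈ CV 𝒱 m)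
    (hg : g ∈ CV 𝒱 n) :
    HasWordDegree (suspTensor 𝒱) (homEnd 𝒱) (m + n) (nambuWordCirc 𝒱 n f g) := by
  have hG := hasWordDegree_wordEval_iff.2 (Psi_mem_CLV 𝒱 hg)
  rw [← hasWordDegree_nambuEval_iff] at hf hg
  exact (hf.lcirc hG).add (hf.lconv mul_mem_homEnd hg)

/-- The bracket of Nambu cochains as a function of words. -/
def nambuWordBracket (m n : ℤ) (f g : NambuCochain 𝕜 V) :
    List (ℤ × (V ⊗[𝕜] V)) → Module.End 𝕜 V :=
  nambuWordCirc 𝒱 n f g + (-sign 𝕜 (m * n)) • nambuWordCirc 𝒱 m g f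

/-- After the last letter is separated, the insertion terms are derivation extensions one by one.
The convolution terms are so only in the antisymmetrized combination. -/
theorem wordEval_balavoineBracket_Psi {m n : ℤ} {f g : NambuCochain 𝕜 V} (hf : f ∈ CV 𝒱 m)
    (hg : g ∈ CV 𝒱 n) {l : List (ℤ × (V ⊗[𝕜] V))} {z : ℤ × (V ⊗[𝕜] V)}
    (hl : IsHomWord (suspTensor 𝒱) (l ++ [z])) :
    wordEval (balavoineBracket (suspTensor 𝒱) m n (Psi 𝒱 m f) (Psi 𝒱 n g)) (l ++ [z]) =
      derExt 𝒱 (wordDegree l + (m + n)) (nambuWordBracket 𝒱 m n f g l) z.2 := by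
  rw [wordEval_balavoineBracket _ _ _ _ hl]
  have hl' := (isHomWord_concat.1 hl).1
  have hF := hasWordDegree_wordEval_iff.2 (Psi_mem_CLV 𝒱 hf)
  have hG := hasWordDegree_wordEval_iff.2 (Psi_mem_CLV 𝒱 hg)
  rw [← hasWordDegree_nambuEval_iff] at hf hg
  simp only [lbracket, Pi.sub_apply, Pi.smul_apply,
    lcirc_concat (wordEval_Psi_concat 𝒱 m f) (wordEval_Psi_concat 𝒱 n g),
    lcirc_concat (wordEval_Psi_concat 𝒱 n g) (wordEval_Psi_concat 𝒱 m f)]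
  have h1 := lcirc_map hG (derExt 𝒱) (psiEval_eq_derExt 𝒱 m f) hl'
  have h2 := lcirc_map hF (derExt 𝒱) (psiEval_eq_derExt 𝒱 n g) hl'
  have h3 := lconv_commutator (derExt 𝒱) (homEnd 𝒱) (derExt_commutator 𝒱) hf hg
    (psiEval_eq_derExt 𝒱 m f) (psiEval_eq_derExt 𝒱 n g) hl'
  rw [add_comm n m] at h2
  rw [← LinearMap.smul_apply, ← LinearMap.sub_apply]
  congr 1
  rw [h1, h2]
  simp only [nambuWordBracket, nambuWordCirc, Pi.add_apply, Pi.smul_apply]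
  rw [← sub_eq_zero] at h3 ⊢
  rw [← h3]
  simp only [map_add, map_sub, map_smul]
  module

/-- The preimage is glued from `nambuWordBracket`, which is letter-wise linear and depends on
degrees only modulo two. Existence holds in every characteristic; uniqueness is where `2 ≠ 0`
enters. -/
theorem exists_Psi_eq_bracket {m n : ℤ} {f g : NambuCochain 𝕜 V} (hf : f ∈ CV 𝒱 m)
    (hg : g ∈ CV 𝒱 n) : ∃ h ∈ CV 𝒱 (m + n),
      Psi 𝒱 (m + n) h = balavoineBracket (suspTensor 𝒱) m n (Psi 𝒱 m f) (Psi 𝒱 n g) ∧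
      ∀ l, IsHomWord (suspTensor 𝒱) l → nambuEval h l = nambuWordBracket 𝒱 m n f g l := by
  have hK : WordLinear 𝕜 (nambuWordBracket 𝒱 m n f g) :=
    (wordLinear_nambuWordCirc 𝒱 n f g).add_fun
      ((wordLinear_nambuWordCirc 𝒱 m g f).smul_fun _)
  have hKd : HasWordDegree (suspTensor 𝒱) (homEnd 𝒱) (m + n) (nambuWordBracket 𝒱 m n f g) :=
    (hasWordDegree_nambuWordCirc 𝒱 hf hg).add
      ((add_comm n m ▸ hasWordDegree_nambuWordCirc 𝒱 hg hf :
        HasWordDegree (suspTensor 𝒱) (homEnd 𝒱) (m + n) (nambuWordCirc 𝒱 m g f)).smul _)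
  -- The factor `triSign` compensates the one built into `nambuEval`.
  set h : NambuCochain 𝕜 V := fun a => triSign 𝕜 a •
    homogeneousGlue (suspTensor 𝒱) fun d : Fin a → ℤ => hK.toMultilinearMap d with hh
  have hh' : ∀ l, IsHomWord (suspTensor 𝒱) l →
      nambuEval h l = nambuWordBracket 𝒱 m n f g l := by
    intro l hl
    rw [← familyEval_glue (suspTensor 𝒱) hK (fun l l' h => ?_) hl, nambuEval, hh]
    · simp only [smul_smul, triSign_mul_self, one_smul]
    · simp only [nambuWordBracket, Pi.add_apply, Pi.smul_apply, nambuWordCirc_congr 𝒱 _ _ _ h]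
  have hmem : h ∈ CV 𝒱 (m + n) := hasWordDegree_nambuEval_iff.1 fun l hl => by
    rw [hh' l hl]
    exact hKd l hl
  refine ⟨h, hmem, leibnizCochain_ext (suspTensor 𝒱) fun l hl => ?_, hh'⟩
  induction l using List.reverseRecOn with
  | nil => simp
  | append_singleton l z _ =>
    have hl' := (isHomWord_concat.1 hl).1
    rw [wordEval_balavoineBracket_Psi 𝒱 hf hg hl, wordEval_Psi_concat,
      psiEval_eq_derExt 𝒱 _ h l hl', hh' l hl']

theorem courant_spec {m n : ℤ} {f g : NambuCochain 𝕜 V} (hf : f ∈ CV 𝒱 m)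
    (hg : g ∈ CV 𝒱 n) : courant 𝒱 m n f g ∈ CV 𝒱 (m + n) ∧
      Psi 𝒱 (m + n) (courant 𝒱 m n f g) =
        balavoineBracket (suspTensor 𝒱) m n (Psi 𝒱 m f) (Psi 𝒱 n g) := by
  obtain ⟨h, hh, he, -⟩ := exists_Psi_eq_bracket 𝒱 hf hg
  exact ⟨Function.invFunOn_mem ⟨h, hh, he⟩, Function.invFunOn_eq ⟨h, hh, he⟩⟩

theorem nambuEval_courant (two_ne_zero : (2 : 𝕜) ≠ 0) {m n : ℤ} {f g : NambuCochain 𝕜 V}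
    (hf : f ∈ CV 𝒱 m) (hg : g ∈ CV 𝒱 n) {l : List (ℤ × (V ⊗[𝕜] V))}
    (hl : IsHomWord (suspTensor 𝒱) l) :
    nambuEval (courant 𝒱 m n f g) l = nambuWordBracket 𝒱 m n f g l := by
  obtain ⟨h, hh, he, hb⟩ := exists_Psi_eq_bracket 𝒱 hf hg
  obtain ⟨h1, h2⟩ := courant_spec 𝒱 hf hg
  rw [Psi_injOn 𝒱 two_ne_zero (m + n) h1 hh (h2.trans he.symm), hb l hl]

theorem circTerm_nambu (n : ℤ) (f g : NambuCochain 𝕜 V) {a b : ℕ}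
    (d : Fin (a + b) → ℤ) (X : Fin (a + b) → V ⊗[𝕜] V) (k : Fin a)
    {σ : Equiv.Perm (Fin (a + b))} (hσ : σ ∈ shuffles (a + b) k b) :
    circTerm (𝕜 := 𝕜) n (wordEval (Psi 𝒱 n g)) (nambuEval f) (fun i => (d i + 1, X i)) k b σ =
      (triSign 𝕜 a * triSign 𝕜 b) • (sign 𝕜 (n * leadingDegree (fun i => d i + 1) σ k) *
            koszulSign 𝕜 (fun i => d i + 1) σ) •
          f a (fun t =>
              if (t : ℕ) < k then X (σ ⟨t, by omega⟩)
              else if t = k then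
                leibnizExt 𝒱 (n + b) (g b) (fun r => X (σ ⟨k + r, by omega⟩)) (X ⟨k + b, by omega⟩)
              else X ⟨t + b, by omega⟩) := by
  have hk := k.2
  have hfix := (mem_shuffles.1 hσ).2.2
  rw [circTerm]
  set L := List.ofFn fun i => (d (σ i) + 1, X (σ i)) with hL
  have hlen : L.length = a + b := by simp [hL]
  have hp : (L.take k).length = k := by simp [hlen]; omega
  rw [wordEval_eq (a := b) _ (by simp [hlen]; omega), Psi_apply, (wordLinear_nambuEval f).smul,
    nambuEval_eq (a := a) _ (by simp [hlen]; omega), smul_comm]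
  rw [smul_comm _ (triSign 𝕜 a), smul_smul, mul_comm (triSign 𝕜 b)]
  congr 3
  funext t
  have ht := t.2
  rw [letters_append_cons hp]
  simp only [Fin.ext_iff]
  split_ifs with h1 h2
  · rw [letters_take _ h1, hL, letters_ofFn _ (by omega)]
  · congr 1
    · congr 1
      funext r
      rw [letters_take _ (by simp), letters_drop, hL, letters_ofFn _ (by simp; omega)]
      rfl
    · rw [letters_take _ (by simp), letters_drop, hL, letters_ofFn _ (by simp)]
      simp only [Fin.val_last]
      -- The shuffle fixes all places from `k + b` on, so the last argument of `g` is `X` at `k + b`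
      -- itself.
      rw [hfix _ (by simp)]
  · rw [letters_drop, hL, letters_ofFn _ (by omega)]
    simp only
    rw [hfix _ (by simp; omega)]
    congr 1
    ext
    simp; omega

theorem convTerm_nambu (n : ℤ) (f g : NambuCochain 𝕜 V) {a b : ℕ}
    (d : Fin (a + b) → ℤ) (X : Fin (a + b) → V ⊗[𝕜] V) (σ : Equiv.Perm (Fin (a + b))) :
    convTerm (𝕜 := 𝕜) n (nambuEval f) (nambuEval g) (fun i => (d i + 1, X i)) a σ =
      (triSign 𝕜 a * triSign 𝕜 b) • (sign 𝕜 (n * leadingDegree (fun i => d i + 1) σ a) *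
            koszulSign 𝕜 (fun i => d i + 1) σ) •
          (f a (fun t => X (σ ⟨t, by omega⟩)) * g b (fun r => X (σ ⟨a + r, by omega⟩)) :
            Module.End 𝕜 V) := by
  rw [convTerm]
  set L := List.ofFn fun i => (d (σ i) + 1, X (σ i)) with hL
  have hlen : L.length = a + b := by simp [hL]
  rw [nambuEval_eq (a := a) _ (by simp [hlen]), nambuEval_eq (a := b) _ (by simp [hlen]),
    smul_mul_smul_comm, smul_comm]
  congr 4
  · funext t
    rw [letters_take _ t.2, hL, letters_ofFn _ (by omega)]
  · funext t
    rw [letters_drop, hL, letters_ofFn _ (by omega)]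

theorem nambuCircComponent_eq (n : ℤ) (f g : NambuCochain 𝕜 V) {a b s : ℕ} (h : a + b = s)
    (d : Fin s → ℤ) (X : Fin s → V ⊗[𝕜] V) (x : V) :
    nambuCircComponent 𝒱 n (f a) (g b) (fun i => d (Fin.cast h i)) (fun i => X (Fin.cast h i)) x =
      triSign 𝕜 s • (∑ k ∈ Finset.range a, ∑ σ ∈ shuffles s k b,
        circTerm (𝕜 := 𝕜) n (wordEval (Psi 𝒱 n g)) (nambuEval f) (fun i => (d i + 1, X i)) k b σ +
        ∑ σ ∈ shuffles s a b, convTerm (𝕜 := 𝕜) n (nambuEval f) (nambuEval g)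
          (fun i => (d i + 1, X i)) a σ) x := by
  subst h
  have hs : triSign 𝕜 (a + b) * (triSign 𝕜 a * triSign 𝕜 b) = sign 𝕜 (a * b) := by
    rw [triSign_mul, ← mul_assoc, triSign_mul_self, one_mul]
  rw [Finset.sum_range, Finset.sum_congr rfl fun k _ => Finset.sum_congr rfl fun σ hσ =>
    circTerm_nambu 𝒱 n f g d X k hσ]
  simp only [convTerm_nambu, ← Finset.smul_sum, ← smul_add]
  rw [LinearMap.smul_apply, smul_smul, hs, nambuCircComponent]
  simp only [LinearMap.add_apply, LinearMap.sum_apply, LinearMap.smul_apply,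
    Module.End.mul_apply, Fin.cast_eq_self]

/-- The degrees `d` are formal labels here: the shuffle expansions of `lcirc` and `lconv` hold for
any labels, so no homogeneity of `X` is required. -/
theorem nambuCirc_eq (n : ℤ) (f g : NambuCochain 𝕜 V) (s : ℕ) (d : Fin s → ℤ)
    (X : Fin s → V ⊗[𝕜] V) (x : V) : nambuCirc 𝒱 n f g s d X x =
      triSign 𝕜 s • nambuWordCirc 𝒱 n f g (List.ofFn fun i => (d i + 1, X i)) x := by
  rw [nambuCirc, Finset.sum_congr rfl fun p _ => nambuCircComponent_eq 𝒱 n f g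
    (Finset.HasAntidiagonal.mem_antidiagonal.mp p.2) d X x]
  rw [nambuWordCirc, Pi.add_apply, lcirc_ofFn, lconv_ofFn, ← sum_antidiagonal_sum_range,
    ← sum_antidiagonal_attach s fun a b => ∑ k ∈ Finset.range a, ∑ σ ∈ shuffles s k b,
        circTerm (𝕜 := 𝕜) n (wordEval (Psi 𝒱 n g)) (nambuEval f) (fun i => (d i + 1, X i)) k b σ,
    ← sum_antidiagonal_attach s fun a b => ∑ σ ∈ shuffles s a b, convTerm (𝕜 := 𝕜) n
      (nambuEval f) (nambuEval g) (fun i => (d i + 1, X i)) a σ, ← Finset.sum_add_distrib,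
    LinearMap.sum_apply, Finset.smul_sum]

theorem courant_apply (two_ne_zero : (2 : 𝕜) ≠ 0) {m n : ℤ} {f g : NambuCochain 𝕜 V}
    (hf : f ∈ CV 𝒱 m) (hg : g ∈ CV 𝒱 n) (s : ℕ) (d : Fin s → ℤ) (X : Fin s → V ⊗[𝕜] V) (x : V)
    (hX : ∀ i, X i ∈ tensorGrading 𝒱 (d i)) :
    courant 𝒱 m n f g s X x =
      nambuCirc 𝒱 n f g s d X x - sign 𝕜 (m * n) • nambuCirc 𝒱 m g f s d X x := by
  have hl : IsHomWord (suspTensor 𝒱) (List.ofFn fun i => (d i + 1, X i)) :=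
    isHomWord_ofFn.2 fun i => by simpa [suspension] using hX i
  have h := congrArg (fun φ => triSign 𝕜 s • φ x) (nambuEval_courant 𝒱 two_ne_zero hf hg hl)
  simp only [nambuEval_ofFn, LinearMap.smul_apply, smul_smul, triSign_mul_self, one_smul] at h
  rw [h, nambuCirc_eq, nambuCirc_eq]
  simp only [nambuWordBracket, Pi.add_apply, Pi.smul_apply, LinearMap.add_apply,
    LinearMap.smul_apply]
  module

end NambuWords

/-! ### Transport of a graded Lie structure along injective maps -/

section Transport

variable {𝕜 : Type u} [Field 𝕜] {M N : Type v} [AddCommGroup M] [Module 𝕜 M]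
  [AddCommGroup N] [Module 𝕜 N]

theorem IsGradedLieAlgebra.of_injOn {L : ℤ → Submodule 𝕜 M} {br : ℤ → ℤ → M → M → M}
    (hL : IsGradedLieAlgebra L br) {S : ℤ → Submodule 𝕜 N} {br' : ℤ → ℤ → N → N → N}
    (Φ : ℤ → N →ₗ[𝕜] M) (hΦ : ∀ n, ∀ f ∈ S n, Φ n f ∈ L n)
    (hinj : ∀ n, Set.InjOn (Φ n) (S n))
    (hmem : ∀ m n, ∀ f ∈ S m, ∀ g ∈ S n, br' m n f g ∈ S (m + n))
    (hbr : ∀ m n, ∀ f ∈ S m, ∀ g ∈ S n, Φ (m + n) (br' m n f g) = br m n (Φ m f) (Φ n g)) :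
    IsGradedLieAlgebra S br' where
  mem := hmem
  add_left m n f hf f' hf' g hg := by
    have h := Submodule.add_mem _ hf hf'
    refine hinj (m + n) (hmem m n _ h g hg)
      (Submodule.add_mem _ (hmem m n f hf g hg) (hmem m n f' hf' g hg)) ?_
    rw [hbr m n _ h g hg, map_add, map_add, hbr m n f hf g hg, hbr m n f' hf' g hg,
      hL.add_left m n _ (hΦ m f hf) _ (hΦ m f' hf') _ (hΦ n g hg)]
  smul_left m n c f hf g hg := by
    have h := Submodule.smul_mem _ c hf
    refine hinj (m + n) (hmem m n _ h g hg) (Submodule.smul_mem _ c (hmem m n f hf g hg)) ?_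
    rw [hbr m n _ h g hg, map_smul, map_smul, hbr m n f hf g hg,
      hL.smul_left m n c _ (hΦ m f hf) _ (hΦ n g hg)]
  add_right m n f hf g hg g' hg' := by
    have h := Submodule.add_mem _ hg hg'
    refine hinj (m + n) (hmem m n f hf _ h)
      (Submodule.add_mem _ (hmem m n f hf g hg) (hmem m n f hf g' hg')) ?_
    rw [hbr m n f hf _ h, map_add, map_add, hbr m n f hf g hg, hbr m n f hf g' hg',
      hL.add_right m n _ (hΦ m f hf) _ (hΦ n g hg) _ (hΦ n g' hg')]
  smul_right m n c f hf g hg := by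
    have h := Submodule.smul_mem _ c hg
    refine hinj (m + n) (hmem m n f hf _ h) (Submodule.smul_mem _ c (hmem m n f hf g hg)) ?_
    rw [hbr m n f hf _ h, map_smul, map_smul, hbr m n f hf g hg,
      hL.smul_right m n c _ (hΦ m f hf) _ (hΦ n g hg)]
  antisymm m n f hf g hg := by
    have h := hmem n m g hg f hf
    have h' := hbr n m g hg f hf
    rw [add_comm n m] at h h'
    refine hinj (m + n) (hmem m n f hf g hg)
      (Submodule.neg_mem _ (Submodule.smul_mem _ _ h)) ?_
    rw [hbr m n f hf g hg, map_neg, map_smul, h',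
      hL.antisymm m n _ (hΦ m f hf) _ (hΦ n g hg)]
  jacobi m n p f hf g hg h hh := by
    have hgh := hmem n p g hg h hh
    have hfg := hmem m n f hf g hg
    have hfh := hmem m p f hf h hh
    have m1 := hmem _ _ _ hfg h hh
    have e1 := hbr _ _ _ hfg h hh
    have m2 := hmem _ _ g hg _ hfh
    have e2 := hbr _ _ g hg _ hfh
    -- `Φ` is indexed by the degree, so all three terms must be brought to the common index `m + (n
    -- + p)` before injectivity applies.
    rw [add_assoc] at m1 e1
    rw [show n + (m + p) = m + (n + p) by ring] at m2 e2
    refine hinj (m + (n + p)) (hmem m _ f hf _ hgh)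
      (Submodule.add_mem _ m1 (Submodule.smul_mem _ _ m2)) ?_
    rw [hbr m _ f hf _ hgh, map_add, map_smul, e1, e2, hbr n p g hg h hh, hbr m n f hf g hg,
      hbr m p f hf h hh, hL.jacobi m n p _ (hΦ m f hf) _ (hΦ n g hg) _ (hΦ p h hh)]

end Transport

end Nambu
end

/-- Let `V` be a graded vector space over a field of characteristic not two. The map `Ψ` is an
injective graded linear map from `CV` to `CLV` of `s(V ⊗ V)`, its image is a graded Lie subalgebra
for the graded Balavoine bracket, the transported bracket makes `CV` a graded Lie algebra (and is
given by an explicit formula), and its Maurer-Cartan elements are exactly the homotopy Nambu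
algebra structures on `V`. -/
theorem mainTheorem3 {𝕜 : Type*} [Field 𝕜] (two_ne_zero : (2 : 𝕜) ≠ 0)
    {V : Type*} [AddCommGroup V] [Module 𝕜 V]
    (𝒱 : ℤ → Submodule 𝕜 V) [DirectSum.Decomposition 𝒱] :
    (∀ n : ℤ, Set.MapsTo (Nambu.Psi 𝒱 n) (Nambu.CV 𝒱 n) (Nambu.CLV (Nambu.suspTensor 𝒱) n) ∧
      Set.InjOn (Nambu.Psi 𝒱 n) (Nambu.CV 𝒱 n)) ∧
    Nambu.IsGradedLieSubalgebra (Nambu.CLV (Nambu.suspTensor 𝒱))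
      (Nambu.balavoineBracket (Nambu.suspTensor 𝒱))
      (fun n => (Nambu.CV 𝒱 n).map (Nambu.Psi 𝒱 n)) ∧
    Nambu.IsGradedLieAlgebra (Nambu.CV 𝒱) (Nambu.courant 𝒱) ∧
    (∀ m n : ℤ, ∀ f ∈ Nambu.CV 𝒱 m, ∀ g ∈ Nambu.CV 𝒱 n,
      Nambu.Psi 𝒱 (m + n) (Nambu.courant 𝒱 m n f g) =
        Nambu.balavoineBracket (Nambu.suspTensor 𝒱) m n (Nambu.Psi 𝒱 m f) (Nambu.Psi 𝒱 n g) ∧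
      ∀ (s : ℕ) (d : Fin s → ℤ) (X : Fin s → V ⊗[𝕜] V) (x : V),
        (∀ i, X i ∈ Nambu.tensorGrading 𝒱 (d i)) →
          Nambu.courant 𝒱 m n f g s X x =
            Nambu.nambuCirc 𝒱 n f g s d X x -
              Nambu.sign 𝕜 (m * n) • Nambu.nambuCirc 𝒱 m g f s d X x) ∧
    (∀ O : Nambu.NambuCochain 𝕜 V,
      Nambu.IsMaurerCartan (Nambu.CV 𝒱) (Nambu.courant 𝒱) O ↔ Nambu.IsHomotopyNambu 𝒱 O) := by
  have hlie := Nambu.isGradedLieAlgebra_CLV (Nambu.suspTensor 𝒱)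
  refine ⟨fun n => ⟨fun f hf => Nambu.Psi_mem_CLV 𝒱 hf, Nambu.Psi_injOn 𝒱 two_ne_zero n⟩,
    ⟨hlie, ?_, ?_⟩, ?_, ?_, fun O => ⟨?_, ?_⟩⟩
  · rintro n _ ⟨f, hf, rfl⟩
    exact Nambu.Psi_mem_CLV 𝒱 hf
  · rintro m n _ ⟨f, hf, rfl⟩ _ ⟨g, hg, rfl⟩
    obtain ⟨h, hh, he, -⟩ := Nambu.exists_Psi_eq_bracket 𝒱 hf hg
    exact ⟨h, hh, he⟩
  · exact hlie.of_injOn (Nambu.Psi 𝒱) (fun n f hf => Nambu.Psi_mem_CLV 𝒱 hf)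
      (Nambu.Psi_injOn 𝒱 two_ne_zero) (fun m n f hf g hg => (Nambu.courant_spec 𝒱 hf hg).1)
      (fun m n f hf g hg => (Nambu.courant_spec 𝒱 hf hg).2)
  · exact fun m n f hf g hg => ⟨(Nambu.courant_spec 𝒱 hf hg).2,
      Nambu.courant_apply 𝒱 two_ne_zero hf hg⟩
  · rintro ⟨hO, h0⟩
    refine ⟨fun a d c X x hX hx => ?_, fun s d X x hX => ?_⟩
    · rw [add_comm (a : ℤ) 1]
      exact hO a d c X x hX hx
    · have h := Nambu.courant_apply 𝒱 two_ne_zero hO hO s d X x hX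
      rw [h0] at h
      -- In odd degree the two halves of the bracket add up, giving `2 (O ∘ O) = 0`, and `2` can be
      -- cancelled.
      have hs : Nambu.sign 𝕜 (1 * 1) = -1 := by simp [Nambu.sign]
      rw [hs, neg_smul, one_smul, sub_neg_eq_add, ← two_smul 𝕜] at h
      exact (smul_eq_zero.1 h.symm).resolve_left two_ne_zero
  · rintro ⟨hdeg, hid⟩
    have hO : O ∈ Nambu.CV 𝒱 1 := fun a d c X x hX hx => by
      rw [add_comm 1 (a : ℤ)]
      exact hdeg a d c X x hX hx
    refine ⟨hO, funext fun s => ?_⟩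
    refine Nambu.multilinearMap_ext_hom (Nambu.tensorGrading 𝒱) fun d X hX => ?_
    ext x
    rw [Nambu.courant_apply 𝒱 two_ne_zero hO hO s d X x hX, hid s d X x hX]
    simp
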